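/- There is an absolute constant $N$ such that the following holds for every integer $n\ge N$ and every positive integer $r<(\ln n)^{1/5}$. Let $H=(V,E)$ be a finite $n$-uniform hypergraph (every edge is a set of exactly $n$ vertices) such that $|V|$ is divisible by $r$ and $$|E|\le 0.01\left(\frac{n}{\ln n}\right)^{\frac{r-1}{r}} r^{\,n-1}.$$ Then $H$ is equitably $r$-colorable: there is a coloring of $V$ with $r$ colors such that no edge is monochromatic and the sizes of any two color classes differ by at most one (equivalently, since $r$ divides $|V|$, all $r$ color classes have the same size). -/

import Mathlib

namespace Hypergraph

/-- A hypergraph is `n`-uniform if every edge consists of exactly `n` vertices. -/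
def IsUniform {α : Type*} (H : Hypergraph α) (n : ℕ) : Prop :=
  ∀ e ∈ H.edgeSet, e.encard = n

/-- A colouring of the vertex set is proper if no edge is monochromatic, that is, no edge has all
its vertices of one and the same colour. -/
def IsProperColoring {α : Type*} (H : Hypergraph α) {C : Type*} (c : H.vertexSet → C) : Prop :=
  ∀ e ∈ H.edgeSet, ¬ ∃ i : C, ∀ v : H.vertexSet, (v : α) ∈ e → c v = i

/-- The set of vertices of colour `i`. -/
def colorClass {α : Type*} (H : Hypergraph α) {C : Type*} (c : H.vertexSet → C) (i : C) :
    Set H.vertexSet :=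
  {v | c v = i}

/-- A colouring is equitable if it is proper and the sizes of any two colour classes differ by at
most one. -/
def IsEquitableColoring {α : Type*} (H : Hypergraph α) {C : Type*} (c : H.vertexSet → C) : Prop :=
  H.IsProperColoring c ∧
    ∀ i j : C, (H.colorClass c i).encard ≤ (H.colorClass c j).encard + 1

/-- A hypergraph is equitably `r`-colourable if it has an equitable colouring with `r` colours. -/
def IsEquitablyColorable {α : Type*} (H : Hypergraph α) (r : ℕ) : Prop :=
  ∃ c : H.vertexSet → Fin r, H.IsEquitableColoring c

end Hypergraph

/-!
The case `r = 1` is trivial, as there are no edges. Let `r ≥ 2`, let `m` be the size of the colour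
classes, `L = log n` and `q = (n / L) ^ ((r - 1) / r)`.

If `m` is at most about `n ^ 2 / (2 * L)`, a uniformly random colouring with classes of size `m`
works: drawing without replacement makes a monochromatic edge less likely than `r ^ (1 - n)` by a
factor `q`, so that less than one such edge is expected (`choose_lt_of_small`,
`exists_equitable_of_choose`).

If `m` is larger, the vertices are placed at random on a line, which is divided into blocks, one for
each colour, separated by short bands whose vertices may receive either of the neighbouring colours
(`IsSubdivision`). This is the method of Cherkashin and Kozik, with three additions that make it
equitable.

* The default colouring cuts the vertices, in the order of the line, into `r` consecutive classes of
  equal size (`blockColor`). By Chebyshev's inequality the cuts fall into the bands, close to their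
  expected places (`card_deviation_le`).
* Starting from the default, a vertex of a band changes its colour only if it is the first or the
  last vertex of a chain of edges (`recolor`). The result is proper unless some chain runs from the
  start of a block to the end of a block (`recolor_proper`), and a changed vertex is an end vertex
  of a chain between two default cuts (`exists_chain_of_recolor_ne`). The length of a block and of a
  band is such that at most `1 / 32` chains of the first kind are expected (`full_chain_le`), and
  at most about `q * n ^ (1 / (2 * r))` chains of the second kind (`default_chain_le`). Both are
  first moment bounds, which come from one estimate for the probability of a chain of `l + 1` edges
  in a window of given length (`card_threads_le`).
* All this is done after deleting a set of `r * s` spare vertices with `s` about `m / (12 * r * n)`.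
  The spare set is so small and spread out that shortening the edges at most doubles the total
  weight of the edges (`exists_spread_set`), but it is larger than the number of changed vertices,
  because `r < L ^ (1 / 5)` makes `n ^ (1 / (2 * r))` exceed any fixed power of `L` for large `n`
  (`default_chain_bound_le`). The shortened edges are not monochromatic, so the spare vertices may
  be coloured arbitrarily, and they are used to make all classes equal (`exists_extension`).
-/

namespace EquitableColoring

open Finset

/-! ### Chains of edges threaded by a placement -/

section

variable {V : Type*}

/-- The weight of an edge `A` obtained by deleting vertices from an edge of size `n`. For a full
edge it is `r ^ (-n)`, the probability of lying in a prescribed colour class; every deleted vertex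
costs a factor `3 * r`, where `3` stands for an upper bound of `exp 1`. -/
noncomputable def weight (n r : ℕ) (A : Finset V) : ℝ :=
  (3 * r : ℝ) ^ (n - A.card) / (r : ℝ) ^ n

lemma weight_nonneg (n r : ℕ) (A : Finset V) : 0 ≤ weight n r A := by
  unfold weight; positivity

/-- The edges `A 0, …, A l` are linked through the vertices `v 0, …, v (l - 1)`: consecutive edges
meet exactly in the link `v j`, all other pairs of edges are disjoint. -/
def LinkedBy {l : ℕ} (A : Fin (l + 1) → Finset V) (v : Fin l → V) : Prop :=
  (∀ j, v j ∈ A j.castSucc ∧ v j ∈ A j.succ ∧ ∀ u ∈ A j.castSucc, u ∈ A j.succ → u = v j) ∧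
    ∀ i j : Fin (l + 1), (i : ℕ) + 1 < j → Disjoint (A i) (A j)

/-- Under the placement `f`, each edge `A j` lies between the cut points `X j` and `X (j + 1)`. -/
def Threads {K l : ℕ} (A : Fin (l + 1) → Finset V) (X : Fin (l + 2) → ℕ) (f : V → Fin K) : Prop :=
  ∀ j, ∀ u ∈ A j, X j.castSucc ≤ f u ∧ (f u : ℕ) ≤ X j.succ

lemma LinkedBy.mem_left {l : ℕ} {A : Fin (l + 1) → Finset V} {v : Fin l → V}
    (h : LinkedBy A v) (j : Fin l) : v j ∈ A j.castSucc := (h.1 j).1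

lemma LinkedBy.mem_right {l : ℕ} {A : Fin (l + 1) → Finset V} {v : Fin l → V}
    (h : LinkedBy A v) (j : Fin l) : v j ∈ A j.succ := (h.1 j).2.1

lemma LinkedBy.injective {l : ℕ} {A : Fin (l + 1) → Finset V} {v : Fin l → V}
    (h : LinkedBy A v) : Function.Injective v := by
  have key : ∀ i j : Fin l, i < j → v i ≠ v j := by
    intro i j hij heq
    have h1 := h.mem_left i
    have h2 := h.mem_right j
    rw [← heq] at h2
    refine (Finset.disjoint_left.1 (h.2 i.castSucc j.succ ?_)) h1 h2
    simpa using hij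
  intro i j hij
  rcases lt_trichotomy i j with h' | h' | h'
  · exact absurd hij (key i j h')
  · exact h'
  · exact absurd hij.symm (key j i h')

/-- A vertex lying on two different edges of a linked sequence is a link between consecutive
edges, and it lies on no third edge. -/
lemma LinkedBy.eq_link {l : ℕ} {A : Fin (l + 1) → Finset V} {v : Fin l → V}
    (h : LinkedBy A v) {u : V} {i j : Fin (l + 1)} (hij : i < j) (hi : u ∈ A i) (hj : u ∈ A j) :
    ∃ k : Fin l, i = k.castSucc ∧ j = k.succ ∧ u = v k := by
  have hle : (j : ℕ) ≤ i + 1 := by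
    by_contra hcon
    exact Finset.disjoint_left.1 (h.2 i j (by omega)) hi hj
  have hlt : (i : ℕ) < l := by have := j.2; have : (i : ℕ) < j := hij; omega
  have e1 : i = (⟨i, hlt⟩ : Fin l).castSucc := by ext; simp
  have e2 : j = (⟨i, hlt⟩ : Fin l).succ := by
    ext; simp; have : (i : ℕ) < j := hij; omega
  refine ⟨⟨i, hlt⟩, e1, e2, ?_⟩
  exact (h.1 ⟨i, hlt⟩).2.2 u (e1 ▸ hi) (e2 ▸ hj)

open Classical in
/-- The values available at `u` to a placement threading `A` through `X`. -/
noncomputable def allowed {K l : ℕ} (A : Fin (l + 1) → Finset V) (X : Fin (l + 2) → ℕ) (u : V) :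
    Finset (Fin K) :=
  univ.filter fun y => ∀ j, u ∈ A j → X j.castSucc ≤ y ∧ (y : ℕ) ≤ X j.succ

lemma allowed_card_le {K l : ℕ} {A : Fin (l + 1) → Finset V} {X : Fin (l + 2) → ℕ} {u : V}
    {j : Fin (l + 1)} (hu : u ∈ A j) :
    (allowed (K := K) A X u).card ≤ X j.succ + 1 - X j.castSucc := by
  rw [← Nat.card_Icc, ← Finset.card_map Fin.valEmbedding]
  refine Finset.card_le_card fun y hy => ?_
  simp only [mem_map, allowed, mem_filter, mem_univ, true_and] at hy
  obtain ⟨z, hz, rfl⟩ := hy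
  exact mem_Icc.2 (hz j hu)

open Classical in
/-- For a vertex `u`, the fraction of allowed values is at most the product of the bounds `G j` of
the edges through `u`, corrected at the links, where a single value is allowed. -/
lemma allowed_ratio_le [DecidableEq V] {K l : ℕ} (hK : 0 < K) {A : Fin (l + 1) → Finset V}
    {v : Fin l → V}
    (hA : LinkedBy A v) {X : Fin (l + 2) → ℕ} {G : Fin (l + 1) → ℝ} (hG : ∀ j, 0 < G j)
    (hXG : ∀ j, ((X j.succ + 1 - X j.castSucc : ℕ) : ℝ) / K ≤ G j) (u : V) :
    ((allowed (K := K) A X u).card : ℝ) / K ≤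
      (∏ j, if u ∈ A j then G j else 1) *
        ∏ j : Fin l, if v j = u then (1 / (K * (G j.castSucc * G j.succ)) : ℝ) else 1 := by
  have hK' : (0 : ℝ) < K := by exact_mod_cast hK
  by_cases hlink : ∃ k, v k = u
  · obtain ⟨k, rfl⟩ := hlink
    have e1 : ∀ j : Fin l, v j = v k ↔ j = k := fun j => hA.injective.eq_iff
    have e2 : ∀ j, v k ∈ A j ↔ j = k.castSucc ∨ j = k.succ := by
      intro j
      constructor
      · intro hj
        rcases lt_trichotomy j k.castSucc with h | h | h
        · obtain ⟨k', h1, h2, h3⟩ := hA.eq_link h hj (hA.mem_left k)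
          have := hA.injective h3
          subst this
          have := congrArg Fin.val h2
          simp at this
        · exact Or.inl h
        · obtain ⟨k', h1, h2, h3⟩ := hA.eq_link h (hA.mem_left k) hj
          have := hA.injective h3
          subst this
          exact Or.inr h2
      · rintro (rfl | rfl)
        · exact hA.mem_left k
        · exact hA.mem_right k
    have hne : k.castSucc ≠ k.succ := by
      intro h; have := congrArg Fin.val h; simp at this
    have p1 : (∏ j, if v k ∈ A j then G j else 1) = G k.castSucc * G k.succ := by
      rw [← Finset.prod_filter]
      have : (univ.filter fun j => v k ∈ A j) = {k.castSucc, k.succ} := by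
        ext j; simp [e2]
      rw [this, Finset.prod_pair hne]
    have p2 : (∏ j : Fin l, if v j = v k then
        (1 / (K * (G j.castSucc * G j.succ)) : ℝ) else 1) =
        1 / (K * (G k.castSucc * G k.succ)) := by
      simp only [e1]
      rw [Finset.prod_ite_eq' univ k]
      simp
    rw [p1, p2]
    have h1 : (allowed (K := K) A X (v k)).card ≤ 1 := by
      rw [Finset.card_le_one]
      intro a ha b hb
      simp only [allowed, mem_filter, mem_univ, true_and] at ha hb
      have := (ha _ (hA.mem_left k)).2
      have := (ha _ (hA.mem_right k)).1
      have := (hb _ (hA.mem_left k)).2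
      have := (hb _ (hA.mem_right k)).1
      ext
      simp only [Fin.succ_castSucc] at *
      omega
    have h2 : ((allowed (K := K) A X (v k)).card : ℝ) ≤ 1 := by exact_mod_cast h1
    have g1 := hG k.castSucc
    have g2 := hG k.succ
    rw [div_le_iff₀ hK']
    have : G k.castSucc * G k.succ * (1 / (K * (G k.castSucc * G k.succ))) * K = 1 := by
      field_simp
    rw [this]
    exact h2
  · push Not at hlink
    have p2 : (∏ j : Fin l, if v j = u then
        (1 / (K * (G j.castSucc * G j.succ)) : ℝ) else 1) = 1 :=
      Finset.prod_eq_one fun j _ => by rw [if_neg (hlink j)]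
    rw [p2, mul_one]
    by_cases hu : ∃ j, u ∈ A j
    · obtain ⟨j, hj⟩ := hu
      have e2 : ∀ i, u ∈ A i ↔ i = j := by
        intro i
        refine ⟨fun hi => ?_, fun h => h ▸ hj⟩
        rcases lt_trichotomy i j with h | h | h
        · obtain ⟨k, -, -, h3⟩ := hA.eq_link h hi hj
          exact absurd h3.symm (hlink k)
        · exact h
        · obtain ⟨k, -, -, h3⟩ := hA.eq_link h hj hi
          exact absurd h3.symm (hlink k)
      have p1 : (∏ i, if u ∈ A i then G i else 1) = G j := by
        simp only [e2]
        rw [Finset.prod_ite_eq' univ j]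
        simp
      rw [p1]
      refine le_trans ?_ (hXG j)
      gcongr
      exact allowed_card_le hj
    · push Not at hu
      rw [Finset.prod_eq_one fun j _ => by rw [if_neg (hu j)]]
      rw [div_le_one hK']
      exact_mod_cast (card_le_univ _).trans (by simp)

open Classical in
/-- The linked sequences of `l + 1` edges of `E`, together with cut points in the prescribed sets
`cut`, that are threaded by the placement `f`. -/
noncomputable def chains {K : ℕ} (E : Finset (Finset V)) {l : ℕ} (cut : Fin (l + 2) → Finset ℕ)
    (f : V → Fin K) : Finset ((Fin (l + 1) → Finset V) × (Fin (l + 2) → ℕ)) :=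
  ((Fintype.piFinset fun _ : Fin (l + 1) => E) ×ˢ Fintype.piFinset cut).filter fun p =>
    (∃ v, LinkedBy p.1 v) ∧ Threads p.1 p.2 f

/-- The number of chains of edges threaded by the placement `f`. -/
noncomputable def chainCount {K : ℕ} (E : Finset (Finset V)) {l : ℕ} (cut : Fin (l + 2) → Finset ℕ)
    (f : V → Fin K) : ℕ :=
  (chains E cut f).card

variable [Fintype V] [DecidableEq V]

open Classical in
/-- The number of placements threading a linked sequence of edges through given cut points.
Each of the `l` links has to hit its cut point, and the edge `A j` has to fall into a window of
`X (j + 1) - X j + 1` of the `K` values. Since `x ≤ exp (x - 1)`, only the total length of the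
windows enters. -/
lemma card_threads_le {K l n r : ℕ} (hK : 0 < K) (hr : 0 < r) {A : Fin (l + 1) → Finset V}
    {v : Fin l → V} (hA : LinkedBy A v) (hcard : ∀ j, (A j).card ≤ n) {X : Fin (l + 2) → ℕ}
    (hX : Monotone X) :
    ((univ.filter fun f : V → Fin K => Threads A X f).card : ℝ) ≤
      (K : ℝ) ^ Fintype.card V * ((9 * r ^ 2 / K : ℝ) ^ l *
        Real.exp (n * (r * ((X (Fin.last _) : ℝ) - X 0 + (l + 1)) / K - (l + 1))) *
        ∏ j, weight n r (A j)) := by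
  have hK' : (0 : ℝ) < K := by exact_mod_cast hK
  have hr' : (0 : ℝ) < r := by exact_mod_cast hr
  set z : Fin (l + 1) → ℝ := fun j => r * ((X j.succ : ℝ) - X j.castSucc + 1) / K - 1 with hz
  have hz1 : ∀ j, -1 ≤ z j := by
    intro j
    have : (X j.castSucc : ℝ) ≤ X j.succ := by
      exact_mod_cast hX (Fin.castSucc_lt_succ).le
    have : 0 ≤ r * ((X j.succ : ℝ) - X j.castSucc + 1) / K := by
      apply div_nonneg _ hK'.le
      apply mul_nonneg hr'.le
      linarith
    simp only [hz]; linarith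
  have hzsum : ∑ j, z j = r * ((X (Fin.last _) : ℝ) - X 0 + (l + 1)) / K - (l + 1) := by
    have tel : ∑ j : Fin (l + 1), ((X j.succ : ℝ) - X j.castSucc) = X (Fin.last _) - X 0 := by
      have h1 := Fin.sum_univ_succ (fun i : Fin (l + 2) => (X i : ℝ))
      have h2 := Fin.sum_univ_castSucc (fun i : Fin (l + 2) => (X i : ℝ))
      rw [Finset.sum_sub_distrib]
      linarith
    simp only [hz]
    rw [Finset.sum_sub_distrib, ← Finset.sum_div, ← Finset.mul_sum, Finset.sum_add_distrib, tel]
    simp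
  set G : Fin (l + 1) → ℝ := fun j => Real.exp (z j) / r with hGdef
  have hG : ∀ j, 0 < G j := fun j => by simp only [hGdef]; positivity
  have hXG : ∀ j, ((X j.succ + 1 - X j.castSucc : ℕ) : ℝ) / K ≤ G j := by
    intro j
    have hle : X j.castSucc ≤ X j.succ := hX (Fin.castSucc_lt_succ).le
    rw [Nat.cast_sub (by omega)]
    simp only [hGdef]
    rw [le_div_iff₀ hr']
    have := Real.add_one_le_exp (z j)
    refine le_trans (le_of_eq ?_) this
    simp only [hz]; push_cast; ring
  have hcardeq : (univ.filter fun f : V → Fin K => Threads A X f) =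
      Fintype.piFinset fun u => allowed A X u := by
    ext f
    rw [mem_filter, Fintype.mem_piFinset]
    simp only [mem_filter, mem_univ, true_and, allowed, Threads]
    exact ⟨fun h u j hu => h j u hu, fun h j u hu => h u j hu⟩
  rw [hcardeq, Fintype.card_piFinset]
  have hprod : ((∏ u, (allowed (K := K) A X u).card : ℕ) : ℝ) =
      (K : ℝ) ^ Fintype.card V * ∏ u, ((allowed (K := K) A X u).card : ℝ) / K := by
    rw [Finset.prod_div_distrib, Finset.prod_const, Finset.card_univ]
    rw [mul_div_cancel₀ _ (pow_ne_zero _ hK'.ne')]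
    push_cast
    rfl
  rw [hprod]
  gcongr
  refine (Finset.prod_le_prod (fun u _ => by positivity)
    (fun u _ => allowed_ratio_le hK hA hG hXG u)).trans ?_
  rw [Finset.prod_mul_distrib, Finset.prod_comm, Finset.prod_comm (s := univ (α := V))]
  have e1 : ∀ j, (∏ u, if u ∈ A j then G j else 1) = G j ^ (A j).card := by
    intro j
    rw [← Finset.prod_filter, Finset.prod_const]
    simp
  have e2 : ∀ j : Fin l, (∏ u : V, if v j = u then
      (1 / (K * (G j.castSucc * G j.succ)) : ℝ) else 1) =
      1 / (K * (G j.castSucc * G j.succ)) := by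
    intro j
    rw [Finset.prod_ite_eq univ (v j)]
    simp
  simp only [e1, e2]
  have he : Real.exp 1 ≤ 3 := Real.exp_one_lt_three.le
  have b1 : ∀ j, G j ^ (A j).card ≤ Real.exp (n * z j) * weight n r (A j) := by
    intro j
    obtain ⟨t, ht⟩ := Nat.exists_eq_add_of_le (hcard j)
    have ht' : n - (A j).card = t := by omega
    simp only [hGdef, weight, ht']
    rw [div_pow, ← Real.exp_nat_mul, mul_div_assoc']
    rw [div_le_div_iff₀ (by positivity) (by positivity)]
    have hn : (n : ℝ) = (A j).card + t := by rw [ht]; push_cast; ring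
    have : Real.exp ((A j).card * z j) ≤ Real.exp (n * z j) * 3 ^ t := by
      have h3 : Real.exp (t : ℝ) ≤ 3 ^ t := by
        have : Real.exp (t : ℝ) = Real.exp 1 ^ t := by rw [← Real.exp_nat_mul, mul_one]
        rw [this]; gcongr
      calc Real.exp ((A j).card * z j) ≤ Real.exp (n * z j + t) := by
            apply Real.exp_le_exp.2
            rw [hn]
            have := hz1 j
            have ht0 : (0 : ℝ) ≤ t := Nat.cast_nonneg t
            nlinarith
        _ ≤ _ := by rw [Real.exp_add]; gcongr
    calc Real.exp ((A j).card * z j) * (r : ℝ) ^ n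
        ≤ Real.exp (n * z j) * 3 ^ t * (r : ℝ) ^ n := by gcongr
      _ = Real.exp (n * z j) * (3 * r) ^ t * (r : ℝ) ^ (A j).card := by
          rw [mul_pow]; conv_lhs => rw [ht, pow_add]
          rw [← ht]; ring
  have b2 : ∀ j : Fin l, 1 / (K * (G j.castSucc * G j.succ)) ≤ (9 * r ^ 2 / K : ℝ) := by
    intro j
    rw [div_le_div_iff₀ (mul_pos hK' (mul_pos (hG _) (hG _))) hK']
    have hge : ∀ i, 1 ≤ 3 * r * G i := by
      intro i
      have : Real.exp (-1) ≤ Real.exp (z i) := Real.exp_le_exp.2 (hz1 i)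
      have h3 : 1 ≤ 3 * Real.exp (-1) := by
        rw [Real.exp_neg]
        rw [le_mul_inv_iff₀ (Real.exp_pos 1)]; linarith
      have : 3 * r * G i = 3 * Real.exp (z i) := by simp only [hGdef]; field_simp
      rw [this]; linarith
    have := one_le_mul_of_one_le_of_one_le (hge j.castSucc) (hge j.succ)
    nlinarith
  calc (∏ j, G j ^ (A j).card) * ∏ j : Fin l, 1 / (K * (G j.castSucc * G j.succ))
      ≤ (∏ j, Real.exp (n * z j) * weight n r (A j)) * ∏ j : Fin l, (9 * r ^ 2 / K : ℝ) := by
        apply mul_le_mul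
        · exact Finset.prod_le_prod (fun j _ => (pow_pos (hG j) _).le) fun j _ => b1 j
        · exact Finset.prod_le_prod
            (fun j _ => by have := hG j.castSucc; have := hG j.succ; positivity) fun j _ => b2 j
        · exact Finset.prod_nonneg fun j _ => by have := hG j.castSucc; have := hG j.succ; positivity
        · exact Finset.prod_nonneg fun j _ => mul_nonneg (Real.exp_pos _).le (weight_nonneg _ _ _)
    _ = _ := by
        rw [Finset.prod_mul_distrib, ← Real.exp_sum, ← Finset.mul_sum, hzsum]
        simp
        ring

open Classical in
/-- First moment bound for the number of threaded chains. -/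
lemma sum_chainCount_le {K l n r : ℕ} (hK : 0 < K) (hr : 0 < r) (E : Finset (Finset V))
    (hcard : ∀ A ∈ E, A.card ≤ n) (cut : Fin (l + 2) → Finset ℕ) (B : ℝ)
    (hcut : ∀ X ∈ Fintype.piFinset cut, Monotone X ∧
      n * (r * ((X (Fin.last _) : ℝ) - X 0 + (l + 1)) / K - (l + 1)) ≤ B) :
    ((∑ f : V → Fin K, chainCount E cut f : ℕ) : ℝ) ≤
      (K : ℝ) ^ Fintype.card V * ((∑ A ∈ E, weight n r A) ^ (l + 1) * (9 * r ^ 2 / K : ℝ) ^ l *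
        (∏ j, ((cut j).card : ℝ)) * Real.exp B) := by
  have step : ∑ f : V → Fin K, chainCount E cut f =
      ∑ p ∈ (Fintype.piFinset fun _ : Fin (l + 1) => E) ×ˢ Fintype.piFinset cut,
        (univ.filter fun f : V → Fin K => (∃ v, LinkedBy p.1 v) ∧ Threads p.1 p.2 f).card := by
    simp_rw [chainCount, chains, card_eq_sum_ones, sum_filter]
    rw [Finset.sum_comm]
    exact Finset.sum_congr rfl fun _ _ => Finset.sum_congr rfl fun _ _ => by congr
  rw [step]
  push_cast
  have hw : (∑ A ∈ E, weight n r A) ^ (l + 1) =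
      ∑ A ∈ Fintype.piFinset fun _ : Fin (l + 1) => E, ∏ j, weight n r (A j) := by
    rw [← Finset.prod_univ_sum]; simp
  have hc : (∏ j, ((cut j).card : ℝ)) = ∑ X ∈ Fintype.piFinset cut, (1 : ℝ) := by
    rw [Finset.sum_const, Fintype.card_piFinset]; simp
  calc _ ≤ ∑ p ∈ (Fintype.piFinset fun _ : Fin (l + 1) => E) ×ˢ Fintype.piFinset cut,
        (K : ℝ) ^ Fintype.card V * ((9 * r ^ 2 / K : ℝ) ^ l * Real.exp B) *
          ((∏ j, weight n r (p.1 j)) * 1) := by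
        refine Finset.sum_le_sum fun p hp => ?_
        obtain ⟨hp1, hp2⟩ := mem_product.1 hp
        have hnn : 0 ≤ ∏ j, weight n r (p.1 j) :=
          Finset.prod_nonneg fun j _ => weight_nonneg _ _ _
        by_cases hl : ∃ v, LinkedBy p.1 v
        · obtain ⟨v, hv⟩ := hl
          have := card_threads_le (K := K) hK hr hv
            (fun j => hcard _ (Fintype.mem_piFinset.1 hp1 j)) (hcut _ hp2).1
          refine le_trans ?_ (this.trans ?_)
          · exact_mod_cast Finset.card_le_card (by
              intro f hf
              simp only [mem_filter, mem_univ, true_and] at hf ⊢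
              exact hf.2)
          · rw [mul_one, mul_assoc ((K : ℝ) ^ Fintype.card V)]
            gcongr
            exact (hcut _ hp2).2
        · rw [Finset.filter_false_of_mem]
          · simp only [card_empty, Nat.cast_zero]
            positivity
          · intro f _ h; exact hl h.1
    _ = _ := by
        rw [← Finset.mul_sum, Finset.sum_product' (f := fun (A : Fin (l + 1) → Finset V)
          (_ : Fin (l + 2) → ℕ) => (∏ j, weight n r (A j)) * (1 : ℝ)), ← Finset.sum_mul_sum,
          hw, hc]
        ring

end

/-! ### Recolouring the bands -/

section

/-- The subdivision of the line used for recolouring: colour `i` owns the block `[b i, e i)`, and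
the band `[e i, b (i + 1))` is shared by the colours `i` and `i + 1`. The interval `[lo i, hi i)`
inside the band below block `i` is where the default colour may switch from `i - 1` to `i`. At the
two ends of the line, `lo 0` is the left end and `hi r` is any bound beyond block `r - 1`. -/
structure IsSubdivision (r : ℕ) (b e lo hi : ℕ → ℕ) : Prop where
  b_zero : b 0 = 0
  lo_zero : lo 0 = 0
  b_le_e : ∀ i < r, b i ≤ e i
  e_le_lo : ∀ i, i + 1 < r → e i ≤ lo (i + 1)
  lo_le_hi : ∀ i, i + 1 < r → lo (i + 1) ≤ hi (i + 1)
  hi_le_b : ∀ i, i + 1 < r → hi (i + 1) ≤ b (i + 1)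
  e_le_hi : ∀ i, i + 1 = r → e i ≤ hi (i + 1)

namespace IsSubdivision

variable {r : ℕ} {b e lo hi : ℕ → ℕ}

lemma lo_le_b (h : IsSubdivision r b e lo hi) {i : ℕ} (hi' : i < r) : lo i ≤ b i := by
  cases i with
  | zero => rw [h.lo_zero]; exact Nat.zero_le _
  | succ i => exact (h.lo_le_hi i hi').trans (h.hi_le_b i hi')

lemma e_le_hi' (h : IsSubdivision r b e lo hi) {i : ℕ} (hi' : i < r) : e i ≤ hi (i + 1) := by
  rcases Nat.lt_or_ge (i + 1) r with h1 | h1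
  · exact (h.e_le_lo i h1).trans (h.lo_le_hi i h1)
  · exact h.e_le_hi i (by omega)

end IsSubdivision

variable {V : Type*} [LinearOrder V]

/-- An ordered chain of edges `A 0, …, A l` of `E`, starting at colour `s`: for `j < l`, the vertex
`w j` is the last one of `A j` and the first one of `A (j + 1)`, and it lies in the band above block
`s + j`. The values of `A` and `w` at larger indices are irrelevant. -/
structure OrderedChain (E : Finset (Finset V)) (b e : ℕ → ℕ) (f : V → ℕ) (s l : ℕ)
    (A : ℕ → Finset V) (w : ℕ → V) : Prop where
  mem : ∀ j ≤ l, A j ∈ E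
  last : ∀ j < l, w j ∈ A j ∧ ∀ u ∈ A j, u ≤ w j
  first : ∀ j < l, w j ∈ A (j + 1) ∧ ∀ u ∈ A (j + 1), w j ≤ u
  band : ∀ j < l, e (s + j) ≤ f (w j) ∧ f (w j) < b (s + j + 1)

namespace OrderedChain

variable {E : Finset (Finset V)} {b e : ℕ → ℕ} {f : V → ℕ} {s l : ℕ} {A : ℕ → Finset V} {w : ℕ → V}

lemma single {B : Finset V} (hB : B ∈ E) (s : ℕ) (w : ℕ → V) :
    OrderedChain E b e f s 0 (fun _ => B) w :=
  ⟨fun _ _ => hB, by simp, by simp, by simp⟩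

lemma cons (h : OrderedChain E b e f (s + 1) l A w) {B : Finset V} (hB : B ∈ E) {v : V}
    (hvB : v ∈ B) (hvB' : ∀ u ∈ B, u ≤ v) (hvA : v ∈ A 0) (hvA' : ∀ u ∈ A 0, v ≤ u)
    (hv : e s ≤ f v ∧ f v < b (s + 1)) :
    OrderedChain E b e f s (l + 1) (fun j => Nat.casesOn j B A) (fun j => Nat.casesOn j v w) where
  mem j hj := by
    cases j with
    | zero => exact hB
    | succ j => exact h.mem j (by omega)
  last j hj := by
    cases j with
    | zero => exact ⟨hvB, hvB'⟩
    | succ j => exact h.last j (by omega)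
  first j hj := by
    cases j with
    | zero => exact ⟨hvA, hvA'⟩
    | succ j => exact h.first j (by omega)
  band j hj := by
    cases j with
    | zero => exact hv
    | succ j =>
      have := h.band j (by omega)
      rw [show s + (j + 1) = s + 1 + j by ring]
      exact this

lemma snoc (h : OrderedChain E b e f s l A w) {B : Finset V} (hB : B ∈ E) {v : V}
    (hvA : v ∈ A l) (hvA' : ∀ u ∈ A l, u ≤ v) (hvB : v ∈ B) (hvB' : ∀ u ∈ B, v ≤ u)
    (hv : e (s + l) ≤ f v ∧ f v < b (s + l + 1)) :
    OrderedChain E b e f s (l + 1) (fun j => if j ≤ l then A j else B)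
      (fun j => if j < l then w j else v) where
  mem j hj := by
    by_cases h1 : j ≤ l
    · simpa [h1] using h.mem j h1
    · simpa [h1] using hB
  last j hj := by
    rcases Nat.lt_succ_iff_lt_or_eq.1 hj with h1 | rfl
    · simpa [h1, h1.le] using h.last j h1
    · simpa using ⟨hvA, hvA'⟩
  first j hj := by
    rcases Nat.lt_succ_iff_lt_or_eq.1 hj with h1 | rfl
    · simpa [h1, Nat.succ_le_of_lt h1] using h.first j h1
    · simpa using ⟨hvB, hvB'⟩
  band j hj := by
    rcases Nat.lt_succ_iff_lt_or_eq.1 hj with h1 | rfl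
    · simpa [h1] using h.band j h1
    · simpa using hv

end OrderedChain

/-- `v` is the first vertex of an ordered chain that starts at colour `i + 1` and ends before the
end of a block. Such a vertex of the band above block `i` has to keep colour `i`. -/
def StartsChain (r : ℕ) (E : Finset (Finset V)) (b e : ℕ → ℕ) (f : V → ℕ) (i : ℕ) (v : V) : Prop :=
  ∃ l A w, i + 1 + l < r ∧ OrderedChain E b e f (i + 1) l A w ∧ v ∈ A 0 ∧ (∀ u ∈ A 0, v ≤ u) ∧
    ∀ u ∈ A l, f u < e (i + 1 + l)

/-- `v` is the last vertex of an ordered chain that ends at colour `i` and begins where its first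
colour is the default. Such a vertex of default colour `i` is moved to colour `i + 1`, unless it has
to keep colour `i`. -/
def EndsChain (E : Finset (Finset V)) (b e lo : ℕ → ℕ) (f : V → ℕ) (i : ℕ) (v : V) : Prop :=
  ∃ s l A w, s + l = i ∧ OrderedChain E b e f s l A w ∧ v ∈ A l ∧ (∀ u ∈ A l, u ≤ v) ∧
    ∀ u ∈ A 0, lo s ≤ f u

open Classical in
/-- The default colouring `c` after recolouring the vertices of the bands that start or end
chains. -/
noncomputable def recolor (r : ℕ) (E : Finset (Finset V)) (b e lo : ℕ → ℕ) (f c : V → ℕ) (v : V) :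
    ℕ :=
  if e (c v) ≤ f v ∧ f v < b (c v + 1) then
    if ¬ StartsChain r E b e f (c v) v ∧ EndsChain E b e lo f (c v) v then c v + 1 else c v
  else if 1 ≤ c v ∧ e (c v - 1) ≤ f v ∧ f v < b (c v) then
    if StartsChain r E b e f (c v - 1) v then c v - 1 else c v
  else c v

section

variable {r : ℕ} {b e lo hi : ℕ → ℕ} {E : Finset (Finset V)} {f c : V → ℕ}

lemma recolor_lt (hfK : ∀ v, f v < e (r - 1)) (hc : ∀ v, c v < r) (v : V) :
    recolor r E b e lo f c v < r := by
  have hcv := hc v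
  unfold recolor
  split_ifs with h1
  · by_contra h4
    have h5 : c v = r - 1 := by omega
    have := hfK v
    rw [← h5] at this
    omega
  all_goals omega

/-- The possible positions of a vertex that receives colour `j`. -/
lemma recolor_cases (hS : IsSubdivision r b e lo hi) (hfK : ∀ v, f v < e (r - 1))
    (hc : ∀ v, c v < r) (hchi : ∀ v, ∀ i < r, hi i ≤ f v → i ≤ c v)
    (hclo : ∀ v, ∀ i < r, f v < lo i → c v < i) {v : V} {j : ℕ}
    (hj : recolor r E b e lo f c v = j) :
    (b j ≤ f v ∧ f v < e j) ∨
    (∃ i, j = i + 1 ∧ e i ≤ f v ∧ f v < b (i + 1) ∧ ¬ StartsChain r E b e f i v ∧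
      (c v = j ∨ EndsChain E b e lo f i v)) ∨
    (e j ≤ f v ∧ f v < b (j + 1) ∧ (StartsChain r E b e f j v ∨
      (c v = j ∧ ¬ EndsChain E b e lo f j v))) := by
  unfold recolor at hj
  split_ifs at hj with h1 h2 h3 h4
  · exact Or.inr (Or.inl ⟨c v, hj.symm, h1.1, h1.2, h2.1, Or.inr h2.2⟩)
  · subst hj
    refine Or.inr (Or.inr ⟨h1.1, h1.2, ?_⟩)
    tauto
  · subst hj
    refine Or.inr (Or.inr ⟨h3.2.1, ?_, Or.inl h4⟩)
    rw [Nat.sub_add_cancel h3.1]; exact h3.2.2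
  · subst hj
    refine Or.inr (Or.inl ⟨c v - 1, by omega, h3.2.1, ?_, h4, Or.inl rfl⟩)
    rw [Nat.sub_add_cancel h3.1]; exact h3.2.2
  · subst hj
    left
    have hcv := hc v
    constructor
    · by_contra hlt
      push Not at hlt
      rcases Nat.eq_zero_or_pos (c v) with h0 | h0
      · rw [h0, hS.b_zero] at hlt; omega
      · refine h3 ⟨h0, ?_, hlt⟩
        have h5 := hS.e_le_lo (c v - 1) (by omega)
        rw [Nat.sub_add_cancel h0] at h5
        refine h5.trans ?_
        by_contra h6
        exact lt_irrefl _ (hclo v (c v) hcv (not_le.1 h6))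
    · by_contra hle
      push Not at hle
      rcases Nat.lt_or_ge (c v + 1) r with h5 | h5
      · refine h1 ⟨hle, ?_⟩
        by_contra h6
        have := hchi v (c v + 1) h5 ((hS.hi_le_b _ h5).trans (not_lt.1 h6))
        omega
      · have : c v = r - 1 := by omega
        have := hfK v
        rw [← ‹c v = r - 1›] at this
        omega

/-- If no chain runs from the start of a block to the end of a block, recolouring leaves no
monochromatic edge. -/
lemma recolor_proper [hV : Nonempty V] (hr : 0 < r) (hS : IsSubdivision r b e lo hi)
    (hf : Monotone f)
    (hfK : ∀ v, f v < e (r - 1))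
    (hc : ∀ v, c v < r) (hchi : ∀ v, ∀ i < r, hi i ≤ f v → i ≤ c v)
    (hclo : ∀ v, ∀ i < r, f v < lo i → c v < i)
    (hfull : ∀ s l A w, s + l < r → OrderedChain E b e f s l A w → (∀ u ∈ A 0, b s ≤ f u) →
      ¬ ∀ u ∈ A l, f u < e (s + l)) {B : Finset V} (hB : B ∈ E) (j : ℕ) :
    ∃ v ∈ B, recolor r E b e lo f c v ≠ j := by
  by_contra hmono
  push Not at hmono
  rcases B.eq_empty_or_nonempty with rfl | hne
  · obtain ⟨v⟩ := hV
    exact hfull 0 0 (fun _ => ∅) (fun _ => v) hr (OrderedChain.single hB 0 _) (by simp) (by simp)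
  set u := B.min' hne with hu
  set w := B.max' hne with hw
  have huB : u ∈ B := B.min'_mem hne
  have hwB : w ∈ B := B.max'_mem hne
  have hule : ∀ x ∈ B, u ≤ x := fun x hx => B.min'_le x hx
  have hlew : ∀ x ∈ B, x ≤ w := fun x hx => B.le_max' x hx
  have cu := recolor_cases hS hfK hc hchi hclo (hmono u huB)
  have cw := recolor_cases hS hfK hc hchi hclo (hmono w hwB)
  have hj : j < r := hmono u huB ▸ recolor_lt hfK hc u
  -- An edge ending before block `j` does is contained in the block or starts a chain.
  have hend : f w < e j → False := by
    intro hwe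
    have hwe' : ∀ x ∈ B, f x < e j := fun x hx => (hf (hlew x hx)).trans_lt hwe
    rcases cu with ⟨h1, h2⟩ | ⟨i, rfl, h1, h2, h3, -⟩ | ⟨h1, h2, -⟩
    · exact hfull j 0 _ (fun _ => u) hj (OrderedChain.single hB j _)
        (fun x hx => h1.trans (hf (hule x hx))) hwe'
    · exact h3 ⟨0, _, fun _ => u, hj, OrderedChain.single hB _ _, huB, hule, hwe'⟩
    · exact absurd (hwe' u huB) (not_lt.2 h1)
  rcases cw with ⟨h1, h2⟩ | ⟨i, rfl, h1, h2, -⟩ | ⟨h1, h2, h3⟩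
  · exact hend h2
  · exact hend (h2.trans_le (hS.b_le_e _ hj))
  · rcases h3 with ⟨l, A, x, hl, hch, hwA, hwA', hA⟩ | ⟨hcw, hF⟩
    · have hch' := hch.cons hB hwB hlew hwA hwA' ⟨h1, h2⟩
      have hstart : b j ≤ f u → False := fun hbu =>
        hfull j (l + 1) _ _ (by omega) hch' (fun y hy => hbu.trans (hf (hule y hy)))
          (fun y hy => by rw [show j + (l + 1) = j + 1 + l by ring]; exact hA y hy)
      rcases cu with ⟨h4, -⟩ | ⟨i, rfl, -, -, h6, -⟩ | ⟨h4, -, -⟩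
      · exact hstart h4
      · exact h6 ⟨l + 1, _, _, by omega, hch', huB, hule, fun y hy => by
          rw [show i + 1 + (l + 1) = i + 1 + 1 + l by ring]; exact hA y hy⟩
      · exact hstart ((hS.b_le_e j hj).trans h4)
    · have hstart : lo j ≤ f u → False := fun hlu =>
        hF ⟨j, 0, _, fun _ => u, rfl, OrderedChain.single hB _ _, hwB, hlew,
          fun y hy => hlu.trans (hf (hule y hy))⟩
      rcases cu with ⟨h4, -⟩ | ⟨i, rfl, h4, h5, -, h6 | ⟨s, l, A, x, rfl, hch, huA, huA', hA⟩⟩ |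
        ⟨h4, -, -⟩
      · exact hstart ((hS.lo_le_b hj).trans h4)
      · refine hstart (le_of_not_gt fun hlt => ?_)
        have := hclo u _ hj hlt
        omega
      · refine hF ⟨s, l + 1, _, _, rfl, hch.snoc hB huA huA' huB hule ⟨h4, h5⟩, ?_, ?_, ?_⟩
        · simpa using hwB
        · simpa using hlew
        · simpa using hA
      · exact hstart ((hS.lo_le_b hj).trans ((hS.b_le_e j hj).trans h4))

/-- Every vertex whose colour differs from the default is an end vertex of a chain between two
default thresholds. -/
lemma exists_chain_of_recolor_ne (hS : IsSubdivision r b e lo hi) (hf : Monotone f)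
    (hfK : ∀ v, f v < e (r - 1))
    (hc : ∀ v, c v < r) (hchi : ∀ v, ∀ i < r, hi i ≤ f v → i ≤ c v)
    (hclo : ∀ v, ∀ i < r, f v < lo i → c v < i) {v : V}
    (hv : recolor r E b e lo f c v ≠ c v) :
    ∃ s l A w, s + l < r ∧ OrderedChain E b e f s l A w ∧ (∀ u ∈ A 0, lo s ≤ f u) ∧
      (∀ u ∈ A l, f u ≤ hi (s + l + 1)) ∧
      ((v ∈ A 0 ∧ ∀ u ∈ A 0, v ≤ u) ∨ (v ∈ A l ∧ ∀ u ∈ A l, u ≤ v)) := by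
  unfold recolor at hv
  split_ifs at hv with h1 h2 h3 h4
  · obtain ⟨s, l, A, w, hsl, hch, hvA, hvA', hA⟩ := h2.2
    have hlt : c v + 1 < r := by
      by_contra h4
      have : c v = r - 1 := by have := hc v; omega
      have := hfK v
      rw [← ‹c v = r - 1›] at this
      omega
    refine ⟨s, l, A, w, by omega, hch, hA, fun u hu => ?_, Or.inr ⟨hvA, hvA'⟩⟩
    refine (hf (hvA' u hu)).trans ?_
    rw [hsl]
    by_contra hlt'
    have := hchi v (c v + 1) hlt (not_le.1 hlt').le
    omega
  · exact absurd rfl hv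
  · obtain ⟨l, A, w, hl, hch, hvA, hvA', hA⟩ := h4
    have hcv : c v - 1 + 1 = c v := by omega
    rw [hcv] at hl hch hA
    refine ⟨c v, l, A, w, hl, hch, fun u hu => ?_, fun u hu => ?_, Or.inl ⟨hvA, hvA'⟩⟩
    · refine le_trans ?_ (hf (hvA' u hu))
      by_contra hlt
      exact lt_irrefl _ (hclo v (c v) (hc v) (not_le.1 hlt))
    · exact (hA u hu).le.trans (hS.e_le_hi' hl)
  · exact absurd rfl hv
  · exact absurd rfl hv

end

end

/-! ### Concentration, and consecutive blocks of a linear order -/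

section

variable {V W : Type*} [Fintype V] [DecidableEq V]

/-- Off-diagonal terms vanish: two distinct vertices are placed independently. -/
lemma sum_mul_apply_eq_zero {K : ℕ} (g : Fin K → ℝ) (hg : ∑ y, g y = 0) {u v : V} (huv : u ≠ v) :
    ∑ f : V → Fin K, g (f u) * g (f v) = 0 := by
  have h1 : ∀ f : V → Fin K, g (f u) * g (f v) =
      ∏ x, (if x = u then g (f x) else if x = v then g (f x) else 1) := by
    intro f
    have : ∀ x, (if x = u then g (f x) else if x = v then g (f x) else 1) =
        (if x = u then g (f x) else 1) * (if x = v then g (f x) else 1) := by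
      intro x
      by_cases h : x = u
      · subst h; simp [huv]
      · simp [h]
    simp_rw [this]
    rw [Finset.prod_mul_distrib]
    simp
  simp_rw [h1]
  rw [← Fintype.piFinset_univ, ← Finset.prod_univ_sum (fun _ : V => (univ : Finset (Fin K)))
    (fun x y => if x = u then g y else if x = v then g y else 1)]
  exact Finset.prod_eq_zero (mem_univ u) (by simpa using hg)

lemma sum_apply_eq {K : ℕ} (g : Fin K → ℝ) (u : V) :
    (∑ f : V → Fin K, g (f u)) * K = (K : ℝ) ^ Fintype.card V * ∑ y, g y := by
  have h1 : ∀ f : V → Fin K, g (f u) = ∏ x, (if x = u then g (f x) else 1) := by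
    intro f; simp
  simp_rw [h1]
  rw [← Fintype.piFinset_univ, ← Finset.prod_univ_sum (fun _ : V => (univ : Finset (Fin K)))
    (fun x y => if x = u then g y else 1)]
  have h2 : ∀ x : V, (∑ y : Fin K, if x = u then g y else 1) =
      if x = u then ∑ y, g y else (K : ℝ) := by
    intro x; split_ifs <;> simp
  simp_rw [h2]
  rw [← Finset.mul_prod_erase _ _ (mem_univ u)]
  have h3 : ∏ x ∈ univ.erase u, (if x = u then ∑ y, g y else (K : ℝ)) =
      (K : ℝ) ^ (Fintype.card V - 1) := by
    rw [Finset.prod_congr rfl fun x hx => if_neg (ne_of_mem_erase hx)]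
    rw [Finset.prod_const, card_erase_of_mem (mem_univ u), card_univ]
  have hV : 0 < Fintype.card V := Fintype.card_pos_iff.2 ⟨u⟩
  rw [h3, if_pos rfl, mul_assoc, ← pow_succ, Nat.sub_add_cancel hV, mul_comm]

/-- The variance of the number of vertices placed below `x`. -/
lemma sum_sq_card_sub_le {K x : ℕ} (hK : 0 < K) (hx : x ≤ K) :
    ∑ f : V → Fin K, (((univ.filter fun v => (f v : ℕ) < x).card : ℝ) -
      Fintype.card V * x / K) ^ 2 ≤ (K : ℝ) ^ Fintype.card V * (Fintype.card V / 4) := by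
  have hK' : (0 : ℝ) < K := by exact_mod_cast hK
  set p : ℝ := x / K with hp
  set g : Fin K → ℝ := fun y => (if (y : ℕ) < x then 1 else 0) - p with hg
  have hcnt : ∑ y : Fin K, (if (y : ℕ) < x then (1 : ℝ) else 0) = x := by
    rw [Finset.sum_boole]
    congr 1
    have : (univ.filter fun y : Fin K => (y : ℕ) < x) = univ.map (Fin.castLEEmb hx) := by
      ext y
      simp only [mem_filter, mem_univ, true_and, mem_map, Fin.castLEEmb_apply]
      constructor
      · intro h; exact ⟨⟨y, h⟩, by ext; simp⟩
      · rintro ⟨z, rfl⟩; simp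
    rw [this, card_map, card_univ, Fintype.card_fin]
  have hg0 : ∑ y, g y = 0 := by
    simp only [hg]
    rw [Finset.sum_sub_distrib, hcnt]
    simp [hp]
    field_simp
    simp
  have hg2 : ∑ y, g y * g y ≤ K / 4 := by
    have : ∀ y, g y * g y ≤ 1 / 4 + (1 - 2 * p) * g y := by
      intro y
      simp only [hg]
      split_ifs <;> nlinarith [sq_nonneg (p - 1 / 2)]
    refine (Finset.sum_le_sum fun y _ => this y).trans ?_
    rw [Finset.sum_add_distrib, ← Finset.mul_sum, hg0]
    simp
    linarith
  have hcard : ∀ f : V → Fin K, ((univ.filter fun v => (f v : ℕ) < x).card : ℝ) -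
      Fintype.card V * x / K = ∑ v, g (f v) := by
    intro f
    simp only [hg]
    rw [Finset.sum_sub_distrib, Finset.sum_boole]
    simp [hp]
    ring
  simp_rw [hcard, sq, Finset.sum_mul_sum]
  rw [Finset.sum_comm]
  have hu : ∀ u : V, ∑ f : V → Fin K, ∑ v, g (f u) * g (f v) ≤
      (K : ℝ) ^ Fintype.card V * (1 / 4) := by
    intro u
    rw [Finset.sum_comm, Finset.sum_eq_single u]
    · have := sum_apply_eq (V := V) (fun y => g y * g y) u
      rw [← mul_le_mul_iff_left₀ hK', this]
      calc _ ≤ (K : ℝ) ^ Fintype.card V * (K / 4) := by gcongr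
        _ = _ := by ring
    · intro v _ hv
      exact sum_mul_apply_eq_zero g hg0 hv.symm
    · simp
  refine (Finset.sum_le_sum fun u _ => hu u).trans ?_
  rw [Finset.sum_const, card_univ, nsmul_eq_mul]
  exact le_of_eq (by ring)

/-- Chebyshev's inequality for the number of vertices placed below `x`. -/
lemma card_deviation_le {K x : ℕ} (hK : 0 < K) (hx : x ≤ K) {t : ℝ} (ht : 0 ≤ t) :
    ((univ.filter fun f : V → Fin K => t ≤ |((univ.filter fun v => (f v : ℕ) < x).card : ℝ) -
      Fintype.card V * x / K|).card : ℝ) * t ^ 2 ≤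
      (K : ℝ) ^ Fintype.card V * (Fintype.card V / 4) := by
  refine le_trans ?_ (sum_sq_card_sub_le hK hx)
  rw [← nsmul_eq_mul, ← Finset.sum_const]
  refine (Finset.sum_le_sum fun f hf => ?_).trans
    (Finset.sum_le_sum_of_subset_of_nonneg (filter_subset _ _) fun f _ _ => sq_nonneg _)
  rw [← sq_abs (((univ.filter fun v => (f v : ℕ) < x).card : ℝ) - _)]
  exact pow_le_pow_left₀ ht (mem_filter.1 hf).2 2

section

variable [LinearOrder W] [Fintype W]

/-- The colouring of a linear order that cuts it into consecutive blocks of `m` vertices. -/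
def blockColor (m : ℕ) (v : W) : ℕ :=
  (univ.filter fun u : W => u < v).card / m

lemma card_filter_lt_orderIso {N : ℕ} (φ : Fin N ≃o W) (k : Fin N) :
    (univ.filter fun u : W => u < φ k).card = k := by
  have : (univ.filter fun u : W => u < φ k) = (univ.filter fun j => j < k).map φ.toEmbedding := by
    ext u
    simp only [mem_filter, mem_univ, true_and, mem_map]
    constructor
    · intro h
      exact ⟨φ.symm u, by rwa [φ.symm_apply_lt], φ.apply_symm_apply u⟩
    · rintro ⟨j, hj, rfl⟩
      exact φ.lt_iff_lt.2 hj
  rw [this, card_map, ← Fin.card_Iio k]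
  congr 1
  ext j
  simp

lemma card_blockColor {r m : ℕ} (hW : Fintype.card W = r * m) {i : ℕ} (hi : i < r) :
    (univ.filter fun v : W => blockColor m v = i).card = m := by
  rcases Nat.eq_zero_or_pos m with rfl | hm
  · rw [Nat.mul_zero] at hW
    have := Fintype.card_eq_zero_iff.1 hW
    exact Finset.card_eq_zero.2 (Finset.eq_empty_of_isEmpty _)
  let φ := Fintype.orderIsoFinOfCardEq W hW
  have h1 : (univ.filter fun v : W => blockColor m v = i) =
      (univ.filter fun k : Fin (r * m) => (k : ℕ) / m = i).map φ.toEmbedding := by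
    ext v
    simp only [mem_filter, mem_univ, true_and, mem_map]
    constructor
    · intro h
      refine ⟨φ.symm v, ?_, φ.apply_symm_apply v⟩
      rw [← card_filter_lt_orderIso φ, φ.apply_symm_apply]
      exact h
    · rintro ⟨k, hk, rfl⟩
      have := card_filter_lt_orderIso φ k
      unfold blockColor
      exact (congrArg (· / m) this).trans hk
  have h2 : (univ.filter fun k : Fin (r * m) => (k : ℕ) / m = i).map Fin.valEmbedding =
      Ico (i * m) (i * m + m) := by
    ext k
    simp only [mem_map, mem_filter, mem_univ, true_and, mem_Ico, Fin.valEmbedding_apply]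
    have hdiv : k / m = i ↔ i * m ≤ k ∧ k < i * m + m := by
      rw [Nat.div_eq_iff hm]
      constructor <;> rintro ⟨h1, h2⟩ <;> constructor <;> omega
    constructor
    · rintro ⟨j, hj, rfl⟩
      exact hdiv.1 hj
    · intro h
      refine ⟨⟨k, h.2.trans_le ?_⟩, hdiv.2 h, rfl⟩
      calc i * m + m = (i + 1) * m := by ring
        _ ≤ r * m := Nat.mul_le_mul_right _ hi
  rw [h1, card_map, ← card_map Fin.valEmbedding, h2, Nat.card_Ico]
  omega

lemma blockColor_lt {m i : ℕ} (hm : 0 < m) {v : W} {S : Finset W}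
    (hS : S.card ≤ i * m) (hv : ∀ u ≤ v, u ∈ S) : blockColor m v < i := by
  have hsub : insert v (univ.filter fun u : W => u < v) ⊆ S := by
    intro u hu
    simp only [mem_insert, mem_filter, mem_univ, true_and] at hu
    exact hv u (hu.elim (fun h => h.le) fun h => h.le)
  have := card_le_card hsub
  rw [card_insert_of_notMem (by simp)] at this
  exact (Nat.div_lt_iff_lt_mul hm).2 (by omega)

lemma le_blockColor {m i : ℕ} (hm : 0 < m) {v : W} {S : Finset W}
    (hS : i * m ≤ S.card) (hv : ∀ u ∈ S, u < v) : i ≤ blockColor m v := by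
  have := card_le_card (t := univ.filter fun u : W => u < v)
    (fun u hu => mem_filter.2 ⟨mem_univ u, hv u hu⟩)
  exact (Nat.le_div_iff_mul_le hm).2 (hS.trans this)

end

end

/-! ### Counting the recoloured vertices -/

section

lemma IsSubdivision.b_le_e_of_le {r : ℕ} {b e lo hi : ℕ → ℕ} (h : IsSubdivision r b e lo hi)
    {i j : ℕ} (hij : i ≤ j) (hj : j < r) : b i ≤ e j := by
  induction j, hij using Nat.le_induction with
  | base => exact h.b_le_e i hj
  | succ j hij ih =>
    exact (ih (by omega)).trans ((h.e_le_lo j hj).trans ((h.lo_le_hi j hj).trans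
      ((h.hi_le_b j hj).trans (h.b_le_e _ hj))))

lemma OrderedChain.linkedBy {V : Type*} [LinearOrder V] {r : ℕ} {b e lo hi : ℕ → ℕ}
    (hS : IsSubdivision r b e lo hi) {E : Finset (Finset V)} {f : V → ℕ} (hf : Monotone f)
    {s l : ℕ} (hsl : s + l < r) {A : ℕ → Finset V} {w : ℕ → V}
    (h : OrderedChain E b e f s l A w) :
    LinkedBy (fun j : Fin (l + 1) => A j) (fun j : Fin l => w j) := by
  refine ⟨fun j => ⟨(h.last j j.2).1, (h.first j j.2).1, fun u hu hu' =>
    le_antisymm ((h.last j j.2).2 u hu) ((h.first j j.2).2 u hu')⟩, fun i j hij => ?_⟩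
  rw [Finset.disjoint_left]
  intro u hu hu'
  have hj := j.2
  obtain ⟨k, hk⟩ : ∃ k, (j : ℕ) = k + 1 := ⟨j - 1, by omega⟩
  have h1 : u ≤ w i := (h.last i (by omega)).2 u hu
  have h2 : w k ≤ u := (h.first k (by omega)).2 u (by rw [← hk]; exact hu')
  have h3 := hf (h2.trans h1)
  have h4 := (h.band i (by omega)).2
  have h5 := (h.band k (by omega)).1
  have h6 := hS.b_le_e_of_le (i := s + i + 1) (j := s + k) (by omega) (by omega)
  omega

section

variable {V : Type*} {b e : ℕ → ℕ} {x y s l : ℕ}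

/-- The admissible cut points of a chain of `l + 1` edges starting at colour `s` in the window from
`x` to `y`. -/
def cutSet (b e : ℕ → ℕ) (x y s l : ℕ) (j : Fin (l + 2)) : Finset ℕ :=
  if (j : ℕ) = 0 then {x} else if (j : ℕ) = l + 1 then {y} else Ico (e (s + (j - 1))) (b (s + j))

lemma prod_card_cutSet_le {d : ℕ} (hd : ∀ i < s + l, b (i + 1) - e i ≤ d) :
    ∏ j : Fin (l + 2), ((cutSet b e x y s l j).card : ℝ) ≤ (d : ℝ) ^ l := by
  rw [Fin.prod_univ_succ, Fin.prod_univ_castSucc]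
  have h1 : ((cutSet b e x y s l 0).card : ℝ) = 1 := by simp [cutSet]
  have h2 : ((cutSet b e x y s l (Fin.last l).succ).card : ℝ) = 1 := by simp [cutSet]
  rw [h1, h2, one_mul, mul_one]
  refine (Finset.prod_le_prod (fun _ _ => Nat.cast_nonneg _) (g := fun _ => (d : ℝ)) ?_).trans ?_
  · intro j _
    have hj := j.2
    have := hd (s + j) (by omega)
    have hne : (j : ℕ) ≠ l := by omega
    simp only [cutSet, Fin.val_succ, Fin.val_castSucc, Nat.add_sub_cancel, Nat.succ_ne_zero,
      if_false, Nat.add_right_cancel_iff, hne, Nat.card_Ico]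
    exact_mod_cast this
  · simp

lemma apply_of_mem_cutSet {X : Fin (l + 2) → ℕ} (hX : X ∈ Fintype.piFinset (cutSet b e x y s l)) :
    X 0 = x ∧ X (Fin.last _) = y := by
  rw [Fintype.mem_piFinset] at hX
  constructor
  · simpa [cutSet] using hX 0
  · simpa [cutSet] using hX (Fin.last _)

lemma monotone_of_mem_cutSet {r : ℕ} {lo hi : ℕ → ℕ} (hS : IsSubdivision r b e lo hi)
    (hsl : s + l < r) (hx : x ≤ b s) (hy : e (s + l) ≤ y)
    {X : Fin (l + 2) → ℕ} (hX : X ∈ Fintype.piFinset (cutSet b e x y s l)) : Monotone X := by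
  rw [Fintype.mem_piFinset] at hX
  rw [Fin.monotone_iff_le_succ]
  intro j
  have hj := j.2
  have h1 := hX j.castSucc
  have h2 := hX j.succ
  have hlow : X j.castSucc ≤ b (s + j) := by
    simp only [cutSet, Fin.val_castSucc] at h1
    split_ifs at h1 with h3 h4
    · rw [mem_singleton.1 h1, h3]; exact hx
    · omega
    · exact (mem_Ico.1 h1).2.le
  have hupp : e (s + j) ≤ X j.succ := by
    simp only [cutSet, Fin.val_succ, Nat.succ_ne_zero, if_false, Nat.add_right_cancel_iff,
      Nat.add_sub_cancel] at h2
    split_ifs at h2 with h3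
    · rw [mem_singleton.1 h2, h3]; exact hy
    · exact (mem_Ico.1 h2).1
  exact hlow.trans ((hS.b_le_e _ (by omega)).trans hupp)

/-- An ordered chain inside the window from `x` to `y` is counted by `chainCount`. -/
lemma OrderedChain.mem_chains [LinearOrder V] {r K : ℕ} {lo hi : ℕ → ℕ}
    (hS : IsSubdivision r b e lo hi) {E : Finset (Finset V)} {f : V → Fin K}
    (hf : Monotone fun v => (f v : ℕ)) (hsl : s + l < r) {A : ℕ → Finset V} {w : ℕ → V}
    (h : OrderedChain E b e (fun v => (f v : ℕ)) s l A w) (hx : ∀ u ∈ A 0, x ≤ f u)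
    (hy : ∀ u ∈ A l, (f u : ℕ) ≤ y) :
    ∃ X : Fin (l + 2) → ℕ, ((fun j : Fin (l + 1) => A j), X) ∈ chains E (cutSet b e x y s l) f := by
  refine ⟨fun j => if (j : ℕ) = 0 then x else if (j : ℕ) = l + 1 then y else f (w (j - 1)), ?_⟩
  simp only [chains, mem_filter, mem_product, Fintype.mem_piFinset]
  refine ⟨⟨fun j => h.mem j (by have := j.2; omega), fun j => ?_⟩, ⟨_, h.linkedBy hS hf hsl⟩, ?_⟩
  · simp only [cutSet]
    split_ifs with h1 h2
    · simp
    · simp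
    · have := j.2
      obtain ⟨k, hk⟩ : ∃ k, (j : ℕ) = k + 1 := ⟨j - 1, by omega⟩
      have := h.band k (by omega)
      simpa [hk, mem_Ico, ← add_assoc] using this
  · intro j u hu
    have hj := j.2
    simp only [Fin.val_castSucc, Fin.val_succ, Nat.succ_ne_zero, if_false, Nat.add_sub_cancel,
      Nat.add_right_cancel_iff]
    constructor
    · split_ifs with h1 h2
      · refine hx u ?_
        rw [← h1]; exact hu
      · omega
      · obtain ⟨k, hk⟩ : ∃ k, (j : ℕ) = k + 1 := ⟨j - 1, by omega⟩
        rw [hk, Nat.add_sub_cancel]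
        refine hf ((h.first k (by omega)).2 u ?_)
        rw [← hk]; exact hu
    · split_ifs with h1
      · refine hy u ?_
        rw [← h1]; exact hu
      · exact hf ((h.last j (by omega)).2 u hu)

end

/-- If a placement `f` has no chain from the start of a block to the end of a block, and `c` is a
default colouring compatible with `f`, then there is a proper colouring that differs from `c` in at
most two vertices per chain between default thresholds. -/
lemma exists_proper_of_chainCount {V : Type*} [Fintype V] [LinearOrder V] [Nonempty V] {r K : ℕ}
    {b e lo hi : ℕ → ℕ}
    (hr : 0 < r) (hS : IsSubdivision r b e lo hi) (hK : K = e (r - 1)) {E : Finset (Finset V)}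
    {f : V → Fin K} (hf : Monotone fun v => (f v : ℕ)) {c : V → ℕ}
    (hc : ∀ v, c v < r) (hchi : ∀ v, ∀ i < r, hi i ≤ f v → i ≤ c v)
    (hclo : ∀ v, ∀ i < r, f v < lo i → c v < i)
    (hfull : ∀ s < r, ∀ l < r - s, chainCount E (cutSet b e (b s) (e (s + l)) s l) f = 0) :
    ∃ h : V → ℕ, (∀ v, h v < r) ∧ (∀ B ∈ E, ∀ j, ∃ v ∈ B, h v ≠ j) ∧
      (univ.filter fun v => h v ≠ c v).card ≤ 2 * ∑ s ∈ range r, ∑ l ∈ range (r - s),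
        chainCount E (cutSet b e (lo s) (hi (s + l + 1)) s l) f := by
  classical
  have hfK : ∀ v, (f v : ℕ) < e (r - 1) := fun v => hK ▸ (f v).2
  refine ⟨recolor r E b e lo (fun v => (f v : ℕ)) c, recolor_lt hfK hc, ?_, ?_⟩
  · intro B hB j
    refine recolor_proper hr hS hf hfK hc hchi hclo ?_ hB j
    intro s l A w hsl hch h0 hl
    obtain ⟨X, hX⟩ := hch.mem_chains hS hf hsl h0 (fun u hu => (hl u hu).le)
    have := hfull s (by omega) l (by omega)
    rw [chainCount, Finset.card_eq_zero] at this
    rw [this] at hX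
    exact absurd hX (notMem_empty _)
  · have hsub : (univ.filter fun v => recolor r E b e lo (fun v => (f v : ℕ)) c v ≠ c v) ⊆
        (range r).biUnion fun s => (range (r - s)).biUnion fun l =>
          (chains E (cutSet b e (lo s) (hi (s + l + 1)) s l) f).biUnion fun p =>
            univ.filter fun v => (v ∈ p.1 0 ∧ ∀ u ∈ p.1 0, v ≤ u) ∨
              (v ∈ p.1 (Fin.last l) ∧ ∀ u ∈ p.1 (Fin.last l), u ≤ v) := by
      intro v hv
      obtain ⟨s, l, A, w, hsl, hch, h0, hl, hend⟩ :=
        exists_chain_of_recolor_ne hS hf hfK hc hchi hclo (mem_filter.1 hv).2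
      obtain ⟨X, hX⟩ := hch.mem_chains hS hf hsl h0 hl
      simp only [mem_biUnion, mem_range, mem_filter, mem_univ, true_and]
      exact ⟨s, by omega, l, by omega, (fun j => A j, X), hX, by simpa using hend⟩
    refine (card_le_card hsub).trans ?_
    rw [Finset.mul_sum]
    refine card_biUnion_le.trans (Finset.sum_le_sum fun s _ => ?_)
    rw [Finset.mul_sum]
    refine card_biUnion_le.trans (Finset.sum_le_sum fun l _ => ?_)
    rw [chainCount, mul_comm]
    refine card_biUnion_le_card_mul _ _ _ fun p _ => ?_
    rw [Finset.filter_or]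
    refine (card_union_le _ _).trans (Nat.add_le_add (b := 1) (d := 1) ?_ ?_)
    · refine card_le_one.2 fun u hu v hv => ?_
      simp only [mem_filter, mem_univ, true_and] at hu hv
      exact le_antisymm (hu.2 v hv.1) (hv.2 u hu.1)
    · refine card_le_one.2 fun u hu v hv => ?_
      simp only [mem_filter, mem_univ, true_and] at hu hv
      exact le_antisymm (hv.2 u hu.1) (hu.2 v hv.1)

end

/-! ### The first moment argument -/

section

lemma isSubdivision_of_eq {r κ g D : ℕ} (hr : 2 ≤ r) (hκ : κ = D + 4 * (r - 1) * g) :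
    IsSubdivision r (fun i => i * (κ + 4 * g)) (fun i => i * (κ + 4 * g) + D)
      (fun i => i * κ - g) (fun i => i * κ + g) where
  b_zero := by simp
  lo_zero := by simp
  b_le_e i _ := Nat.le_add_right _ _
  e_le_lo i hi := by
    obtain ⟨t, rfl⟩ : ∃ t, r = i + 2 + t := ⟨r - (i + 2), by omega⟩
    apply Nat.le_sub_of_add_le
    rw [show i + 2 + t - 1 = i + 1 + t by omega] at hκ
    subst hκ
    have : 0 ≤ t * g := Nat.zero_le _
    nlinarith
  lo_le_hi i _ := (Nat.sub_le _ _).trans (Nat.le_add_right _ _)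
  hi_le_b i _ := by nlinarith [Nat.zero_le (i * g)]
  e_le_hi i hi := by
    subst hi
    rw [Nat.add_sub_cancel] at hκ
    subst hκ
    nlinarith

lemma card_blockColor_filter_le {V : Type*} [Fintype V] {h c : V → ℕ} {i m R : ℕ}
    (hc : (univ.filter fun v => c v = i).card = m)
    (hR : (univ.filter fun v => h v ≠ c v).card ≤ R) :
    (univ.filter fun v => h v = i).card ≤ m + R := by
  classical
  have : (univ.filter fun v => h v = i) ⊆
      (univ.filter fun v => c v = i) ∪ univ.filter fun v => h v ≠ c v := by
    intro v hv
    simp only [mem_union, mem_filter, mem_univ, true_and] at hv ⊢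
    by_cases hh : h v = c v
    · left; rw [← hh, hv]
    · exact Or.inr hh
  calc _ ≤ _ := card_le_card this
    _ ≤ _ := card_union_le _ _
    _ ≤ _ := by omega

variable {V : Type*} [Fintype V]

/-- A placement with the right number of vertices below each threshold and without chains from the
start of a block to the end of a block yields a proper colouring with almost equal classes. -/
lemma exists_coloring_of_placement {r m κ g D R : ℕ} (hr : 2 ≤ r) (hm : 0 < m)
    (hκ : κ = D + 4 * (r - 1) * g) (hV : Fintype.card V = r * m) {E : Finset (Finset V)}
    {f : V → Fin (r * κ)}
    (hhi : ∀ i < r, 0 < i → i * m ≤ (univ.filter fun v => (f v : ℕ) < i * κ + g).card)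
    (hlo : ∀ i < r, 0 < i → (univ.filter fun v => (f v : ℕ) < i * κ - g).card ≤ i * m)
    (hfull : ∀ s < r, ∀ l < r - s,
      chainCount E (cutSet (fun i => i * (κ + 4 * g)) (fun i => i * (κ + 4 * g) + D)
        (s * (κ + 4 * g)) ((s + l) * (κ + 4 * g) + D) s l) f = 0)
    (hpart : 2 * ∑ s ∈ range r, ∑ l ∈ range (r - s),
      chainCount E (cutSet (fun i => i * (κ + 4 * g)) (fun i => i * (κ + 4 * g) + D)
        (s * κ - g) ((s + l + 1) * κ + g) s l) f ≤ R) :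
    ∃ h : V → ℕ, (∀ v, h v < r) ∧ (∀ B ∈ E, ∀ j, ∃ v ∈ B, h v ≠ j) ∧
      ∀ i < r, (univ.filter fun v => h v = i).card ≤ m + R := by
  have hpos : 0 < Fintype.card V := by rw [hV]; positivity
  have : Nonempty V := Fintype.card_pos_iff.1 hpos
  -- The placement need not be injective; ties are broken by an arbitrary enumeration.
  let key : V → Lex (Fin (r * κ) × Fin (Fintype.card V)) :=
    fun v => toLex (f v, Fintype.equivFin V v)
  have hkey : Function.Injective key := by
    intro u v huv
    have := congrArg (fun p => (ofLex p).2) huv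
    exact (Fintype.equivFin V).injective this
  let order : LinearOrder V := LinearOrder.lift' key hkey
  have hmono : Monotone fun v => (f v : ℕ) := by
    intro u v huv
    have h1 : key u ≤ key v := huv
    rcases (Prod.Lex.toLex_le_toLex).1 h1 with h2 | h2
    · exact le_of_lt h2
    · exact le_of_eq (congrArg Fin.val h2.1)
  have hlt : ∀ u v : V, (f u : ℕ) < f v → u < v := fun u v huv =>
    lt_of_not_ge fun hvu => absurd (hmono hvu) (not_le.2 huv)
  have hK : r * κ = (r - 1) * (κ + 4 * g) + D := by
    obtain ⟨t, rfl⟩ : ∃ t, r = t + 1 := ⟨r - 1, by omega⟩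
    rw [Nat.add_sub_cancel] at hκ ⊢
    subst hκ
    ring
  obtain ⟨h, h1, h2, h3⟩ := exists_proper_of_chainCount (c := blockColor m) (by omega)
    (isSubdivision_of_eq hr hκ) hK hmono
    (fun v => blockColor_lt hm (S := univ) (by rw [card_univ, hV]) fun u _ => mem_univ u)
    (fun v i hi hv => by
      rcases Nat.eq_zero_or_pos i with rfl | hi0
      · exact Nat.zero_le _
      · refine le_blockColor hm (hhi i hi hi0) fun u hu => hlt u v ?_
        exact (mem_filter.1 hu).2.trans_le hv)
    (fun v i hi hv => by
      rcases Nat.eq_zero_or_pos i with rfl | hi0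
      · simp at hv
      · refine blockColor_lt hm (hlo i hi hi0) fun u hu => mem_filter.2 ⟨mem_univ u, ?_⟩
        exact (hmono hu).trans_lt hv)
    hfull
  exact ⟨h, h1, h2, fun i hi => card_blockColor_filter_le (card_blockColor hV hi) (h3.trans hpart)⟩

lemma sum_geom_le {X : ℕ → ℝ} {C : ℝ} {r : ℕ} (hX0 : ∀ l < r, 0 ≤ X l)
    (hX : ∀ l < r, r * X l ≤ C * (1 / 5) ^ l) (hC : 0 ≤ C) :
    ∑ s ∈ range r, ∑ l ∈ range (r - s), X l ≤ C * (5 / 4) := by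
  have h1 : ∀ s ∈ range r, ∑ l ∈ range (r - s), X l ≤ ∑ l ∈ range r, X l := by
    intro s _
    refine Finset.sum_le_sum_of_subset_of_nonneg (range_subset_range.2 (by omega)) fun l hl _ => ?_
    exact hX0 l (mem_range.1 hl)
  refine (Finset.sum_le_sum h1).trans ?_
  rw [Finset.sum_const, card_range, nsmul_eq_mul, Finset.mul_sum]
  refine (Finset.sum_le_sum fun l hl => hX l (mem_range.1 hl)).trans ?_
  rw [← Finset.mul_sum]
  refine mul_le_mul_of_nonneg_left ?_ hC
  rw [geom_sum_eq (by norm_num)]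
  have : (0 : ℝ) ≤ (1 / 5) ^ r := by positivity
  rw [div_le_iff_of_neg (by norm_num)]
  linarith

/-- The first moment argument: if few full chains and few chains between default thresholds are
expected, and the number of vertices below the thresholds is concentrated, some placement satisfies
`exists_coloring_of_placement`. -/
lemma exists_almost_equitable [DecidableEq V] {r m n κ g D : ℕ} (hr : 2 ≤ r) (hm : 0 < m)
    (hg : 0 < g)
    (hκ : κ = D + 4 * (r - 1) * g) (hV : Fintype.card V = r * m) (E : Finset (Finset V))
    (hE : ∀ A ∈ E, A.card ≤ n) {W M : ℝ} (hW : ∑ A ∈ E, weight n r A ≤ W) (hM : 0 < M)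
    (hfull : ∀ l < r, r * (W ^ (l + 1) * (36 * r ^ 2 * g / κ) ^ l *
      Real.exp (n * ((l + 1) - 4 * (r - 1 - l) * g) / κ)) ≤ 1 / 40 * (1 / 5) ^ l)
    (hpart : ∀ l < r, r * (W ^ (l + 1) * (36 * r ^ 2 * g / κ) ^ l *
      Real.exp (n * (2 * g + (l + 1)) / κ)) ≤ M * (1 / 5) ^ l)
    (hdev : 2 * (r * κ) ^ 2 ≤ m * g ^ 2) :
    ∃ h : V → ℕ, (∀ v, h v < r) ∧ (∀ B ∈ E, ∀ j, ∃ v ∈ B, h v ≠ j) ∧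
      ∀ i < r, ((univ.filter fun v => h v = i).card : ℝ) ≤ m + 10 * M := by
  have hκg : g ≤ κ := by
    obtain ⟨t, rfl⟩ : ∃ t, r = t + 2 := ⟨r - 2, by omega⟩
    rw [show t + 2 - 1 = t + 1 by omega] at hκ
    subst hκ
    nlinarith [Nat.zero_le (t * g), Nat.zero_le D]
  have hκ0 : 0 < κ := hg.trans_le hκg
  have hK : 0 < r * κ := by positivity
  have hSub := isSubdivision_of_eq hr hκ
  have hrR : (0 : ℝ) < r := by positivity
  have hκR : (0 : ℝ) < κ := by positivity
  have hgR : (0 : ℝ) < g := by positivity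
  have hmR : (0 : ℝ) < m := by positivity
  have hκD : (κ : ℝ) = D + 4 * (r - 1) * g := by
    rw [hκ]; push_cast [Nat.cast_sub (show 1 ≤ r by omega)]; ring
  have hW0 : 0 ≤ ∑ A ∈ E, weight n r A := Finset.sum_nonneg fun A _ => weight_nonneg _ _ _
  have hWnn : 0 ≤ W := hW0.trans hW
  set b : ℕ → ℕ := fun i => i * (κ + 4 * g) with hb
  set e : ℕ → ℕ := fun i => i * (κ + 4 * g) + D with he
  set T : ℝ := ((r * κ : ℕ) : ℝ) ^ Fintype.card V with hT
  have hT0 : 0 < T := by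
    have : (0 : ℝ) < (r * κ : ℕ) := by exact_mod_cast hK
    positivity
  have hband : ∀ i, b (i + 1) - e i ≤ 4 * r * g := by
    intro i
    obtain ⟨t, rfl⟩ : ∃ t, r = t + 1 := ⟨r - 1, by omega⟩
    rw [Nat.add_sub_cancel] at hκ
    simp only [hb, he]
    rw [Nat.sub_le_iff_le_add, hκ]
    nlinarith
  -- Expected number of chains in a window, in terms of the length of the window.
  have hcount : ∀ s l x y : ℕ, s + l < r → x ≤ b s → e (s + l) ≤ y → ∀ B : ℝ,
      n * (((y : ℝ) - x + (l + 1)) / κ - (l + 1)) ≤ B →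
      ((∑ f : V → Fin (r * κ), chainCount E (cutSet b e x y s l) f : ℕ) : ℝ) ≤
        T * (W ^ (l + 1) * (36 * r ^ 2 * g / κ) ^ l * Real.exp B) := by
    intro s l x y hsl hx hy B hB
    refine (sum_chainCount_le (r := r) hK (by omega) E hE (cutSet b e x y s l) B ?_).trans ?_
    · intro X hX
      refine ⟨monotone_of_mem_cutSet hSub hsl hx hy hX, ?_⟩
      obtain ⟨h0, h1⟩ := apply_of_mem_cutSet hX
      rw [h0, h1]
      refine le_trans (le_of_eq ?_) hB
      push_cast
      field_simp
    · rw [← hT]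
      gcongr T * (?_ * Real.exp B)
      have h1 := prod_card_cutSet_le (b := b) (e := e) (x := x) (y := y) (s := s) (l := l)
        (d := 4 * r * g) fun i _ => hband i
      calc _ ≤ W ^ (l + 1) * (9 * r ^ 2 / (r * κ : ℕ) : ℝ) ^ l * ((4 * r * g : ℕ) : ℝ) ^ l := by
            gcongr
        _ = _ := by
            rw [mul_assoc, ← mul_pow]
            congr 2
            push_cast
            field_simp
            ring
  set Z : (V → Fin (r * κ)) → ℕ := fun f => ∑ s ∈ range r, ∑ l ∈ range (r - s),
    chainCount E (cutSet b e (s * κ - g) ((s + l + 1) * κ + g) s l) f with hZ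
  set F : (V → Fin (r * κ)) → ℕ := fun f => ∑ s ∈ range r, ∑ l ∈ range (r - s),
    chainCount E (cutSet b e (b s) (e (s + l)) s l) f with hF
  have swap : ∀ C : ℕ → ℕ → (V → Fin (r * κ)) → ℕ,
      ((∑ f, ∑ s ∈ range r, ∑ l ∈ range (r - s), C s l f : ℕ) : ℝ) =
        ∑ s ∈ range r, ∑ l ∈ range (r - s), ((∑ f, C s l f : ℕ) : ℝ) := by
    intro C
    rw [Finset.sum_comm]
    push_cast
    refine Finset.sum_congr rfl fun s _ => ?_
    rw [Finset.sum_comm]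
  have hFsum : ((∑ f, F f : ℕ) : ℝ) ≤ T * (1 / 32) := by
    simp only [hF]
    rw [swap]
    have : ∀ s ∈ range r, ∀ l ∈ range (r - s),
        ((∑ f : V → Fin (r * κ), chainCount E (cutSet b e (b s) (e (s + l)) s l) f : ℕ) : ℝ) ≤
        T * (W ^ (l + 1) * (36 * r ^ 2 * g / κ) ^ l *
          Real.exp (n * ((l + 1) - 4 * (r - 1 - l) * g) / κ)) := by
      intro s hs l hl
      rw [mem_range] at hs hl
      refine hcount s l _ _ (by omega) le_rfl le_rfl _ (le_of_eq ?_)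
      simp only [hb, he]
      push_cast
      rw [mul_div_assoc]
      congr 1
      field_simp
      rw [hκD]
      ring
    refine (Finset.sum_le_sum fun s hs => Finset.sum_le_sum fun l hl => this s hs l hl).trans ?_
    simp_rw [← Finset.mul_sum]
    refine mul_le_mul_of_nonneg_left ?_ hT0.le
    refine (sum_geom_le (fun l _ => by positivity) hfull (by norm_num)).trans (by norm_num)
  have hZsum : ((∑ f, Z f : ℕ) : ℝ) ≤ T * (M * (5 / 4)) := by
    simp only [hZ]
    rw [swap]
    have : ∀ s ∈ range r, ∀ l ∈ range (r - s), ((∑ f : V → Fin (r * κ),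
        chainCount E (cutSet b e (s * κ - g) ((s + l + 1) * κ + g) s l) f : ℕ) : ℝ) ≤
        T * (W ^ (l + 1) * (36 * r ^ 2 * g / κ) ^ l *
          Real.exp (n * (2 * g + (l + 1)) / κ)) := by
      intro s hs l hl
      rw [mem_range] at hs hl
      refine hcount s l _ _ (by omega) (hSub.lo_le_b hs) (hSub.e_le_hi' (by omega)) _ ?_
      rw [mul_div_assoc]
      gcongr
      have h1 : (s : ℝ) * κ - g ≤ ((s * κ - g : ℕ) : ℝ) := by
        have : s * κ ≤ (s * κ - g) + g := by omega
        have : (s * κ : ℝ) ≤ ((s * κ - g : ℕ) : ℝ) + g := by exact_mod_cast this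
        linarith
      rw [sub_le_iff_le_add, div_le_iff₀ hκR]
      push_cast
      field_simp
      linarith
    refine (Finset.sum_le_sum fun s hs => Finset.sum_le_sum fun l hl => this s hs l hl).trans ?_
    simp_rw [← Finset.mul_sum]
    refine mul_le_mul_of_nonneg_left ?_ hT0.le
    exact sum_geom_le (fun l _ => by positivity) hpart hM.le
  -- Deviations of the number of vertices below the thresholds.
  set t : ℝ := m * g / κ with ht
  set bad : ℕ → Finset (V → Fin (r * κ)) := fun x => univ.filter fun f =>
    t ≤ |((univ.filter fun v => (f v : ℕ) < x).card : ℝ) - Fintype.card V * x / (r * κ : ℕ)|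
    with hbad
  have hbadle : ∀ x ≤ r * κ, ((bad x).card : ℝ) * (8 * r) ≤ T := by
    intro x hx
    have h1 := card_deviation_le (V := V) hK hx (t := t) (by positivity)
    rw [← hT] at h1
    have h2 : 2 * r ^ 2 ≤ t ^ 2 / m := by
      have h3 : (2 * (r * κ) ^ 2 : ℝ) ≤ m * g ^ 2 := by exact_mod_cast hdev
      rw [ht, le_div_iff₀ hmR, div_pow, le_div_iff₀ (by positivity)]
      nlinarith
    have h3 : 2 * r ^ 2 * m ≤ t ^ 2 := by rwa [le_div_iff₀ hmR] at h2
    have h4 : ((bad x).card : ℝ) * (2 * r ^ 2 * m) ≤ T * (Fintype.card V / 4) :=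
      (mul_le_mul_of_nonneg_left h3 (Nat.cast_nonneg _)).trans h1
    rw [hV] at h4
    push_cast at h4
    have h5 : (0 : ℝ) < r * m := by positivity
    refine le_of_mul_le_mul_right ?_ h5
    nlinarith
  have hxlo : ∀ i < r, i * κ - g ≤ r * κ := fun i hi =>
    (Nat.sub_le _ _).trans (Nat.mul_le_mul_right _ hi.le)
  have hxhi : ∀ i < r, i * κ + g ≤ r * κ := fun i hi => by
    calc i * κ + g ≤ i * κ + κ := by omega
      _ = (i + 1) * κ := by ring
      _ ≤ r * κ := Nat.mul_le_mul_right _ hi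
  obtain ⟨f, hf1, hf2, hf3⟩ : ∃ f, F f = 0 ∧ (Z f : ℝ) < 5 * M ∧
      ∀ i ∈ range r, f ∉ bad (i * κ - g) ∧ f ∉ bad (i * κ + g) := by
    -- Otherwise every placement contributes at least `1` to a sum whose average is `17 / 32`.
    by_contra hcon
    push Not at hcon
    have hone : ∀ f, (1 : ℝ) ≤ F f + Z f / (5 * M) + ∑ i ∈ range r,
        ((if f ∈ bad (i * κ - g) then 1 else 0) + (if f ∈ bad (i * κ + g) then 1 else 0)) := by
      intro f
      have hs0 : ∀ i ∈ range r, (0 : ℝ) ≤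
          (if f ∈ bad (i * κ - g) then 1 else 0) + (if f ∈ bad (i * κ + g) then 1 else 0) := by
        intro i _; positivity
      have hZ0 : (0 : ℝ) ≤ Z f / (5 * M) := by positivity
      have hF0 : (0 : ℝ) ≤ F f := Nat.cast_nonneg _
      have hS0 := Finset.sum_nonneg hs0
      by_cases h1 : F f = 0
      · by_cases h2 : (Z f : ℝ) < 5 * M
        · obtain ⟨i, hi, hor⟩ := hcon f h1 h2
          have h3 := Finset.single_le_sum hs0 hi
          have h4 : (1 : ℝ) ≤
            (if f ∈ bad (i * κ - g) then 1 else 0) + (if f ∈ bad (i * κ + g) then 1 else 0) := by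
            by_cases h5 : f ∈ bad (i * κ - g)
            · rw [if_pos h5]; split_ifs <;> norm_num
            · rw [if_neg h5, if_pos (hor h5)]; norm_num
          linarith
        · have : 1 ≤ (Z f : ℝ) / (5 * M) := by
            rw [le_div_iff₀ (by positivity)]; linarith
          linarith
      · have : (1 : ℝ) ≤ F f := by exact_mod_cast Nat.one_le_iff_ne_zero.2 h1
        linarith
    have htotal := Finset.sum_le_sum fun f (_ : f ∈ (univ : Finset (V → Fin (r * κ)))) => hone f
    rw [Finset.sum_const, card_univ, Fintype.card_fun, Fintype.card_fin, nsmul_eq_mul, mul_one,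
      Nat.cast_pow, ← hT, Finset.sum_add_distrib, Finset.sum_add_distrib, ← Finset.sum_div,
      Finset.sum_comm] at htotal
    have hb' : ∑ i ∈ range r, ∑ f : V → Fin (r * κ), (((if f ∈ bad (i * κ - g) then 1 else 0) +
        (if f ∈ bad (i * κ + g) then 1 else 0)) : ℝ) ≤ T * (1 / 4) := by
      have : ∀ i ∈ range r, ∑ f : V → Fin (r * κ), (((if f ∈ bad (i * κ - g) then 1 else 0) +
          (if f ∈ bad (i * κ + g) then 1 else 0)) : ℝ) ≤ T / (4 * r) := by
        intro i hi
        rw [mem_range] at hi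
        rw [Finset.sum_add_distrib, Finset.sum_boole, Finset.sum_boole]
        simp only [filter_univ_mem]
        rw [le_div_iff₀ (by positivity)]
        have h1 := hbadle _ (hxlo i hi)
        have h2 := hbadle _ (hxhi i hi)
        nlinarith
      refine (Finset.sum_le_sum this).trans ?_
      rw [Finset.sum_const, card_range, nsmul_eq_mul]
      apply le_of_eq
      field_simp
    have hz' : (∑ f, (Z f : ℝ)) / (5 * M) ≤ T * (1 / 4) := by
      rw [div_le_iff₀ (by positivity)]
      push_cast at hZsum
      nlinarith
    push_cast at hFsum
    linarith
  have hNx : ∀ x : ℕ, (Fintype.card V : ℝ) * x / (r * κ : ℕ) = m * x / κ := by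
    intro x; rw [hV]; push_cast; field_simp
  have hR : 2 * Z f ≤ ⌊10 * M⌋₊ := by
    apply Nat.le_floor
    push_cast
    linarith
  have hhi : ∀ i < r, 0 < i → i * m ≤ (univ.filter fun v => (f v : ℕ) < i * κ + g).card := by
    intro i hi _
    have h1 := (hf3 i (mem_range.2 hi)).2
    simp only [hbad, mem_filter, mem_univ, true_and, not_le, hNx] at h1
    have h2 := (abs_lt.1 h1).1
    have h3 : (m : ℝ) * ((i * κ + g : ℕ) : ℝ) / κ = i * m + t := by
      rw [ht]; push_cast; field_simp
    rw [h3] at h2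
    have h4 : ((i * m : ℕ) : ℝ) < (univ.filter fun v => (f v : ℕ) < i * κ + g).card := by
      push_cast; linarith
    exact (Nat.cast_lt.1 h4).le
  have hlo : ∀ i < r, 0 < i → (univ.filter fun v => (f v : ℕ) < i * κ - g).card ≤ i * m := by
    intro i hi hi0
    have h1 := (hf3 i (mem_range.2 hi)).1
    simp only [hbad, mem_filter, mem_univ, true_and, not_le, hNx] at h1
    have h2 := (abs_lt.1 h1).2
    have hle : g ≤ i * κ := hκg.trans (Nat.le_mul_of_pos_left _ hi0)
    have h3 : (m : ℝ) * ((i * κ - g : ℕ) : ℝ) / κ = i * m - t := by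
      rw [ht, Nat.cast_sub hle]; push_cast; field_simp
    rw [h3] at h2
    have h4 : ((univ.filter fun v => (f v : ℕ) < i * κ - g).card : ℝ) < (i * m : ℕ) := by
      push_cast; linarith
    exact (Nat.cast_lt.1 h4).le
  obtain ⟨h, h1, h2, h3⟩ := exists_coloring_of_placement hr hm hκ hV hhi hlo
    (fun s hs l hl => Finset.sum_eq_zero_iff.1 (Finset.sum_eq_zero_iff.1 hf1 s (mem_range.2 hs)) l
      (mem_range.2 hl)) hR
  refine ⟨h, h1, h2, fun i hi => ?_⟩
  have h4 : (⌊10 * M⌋₊ : ℝ) ≤ 10 * M := Nat.floor_le (by positivity)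
  have h5 : ((univ.filter fun v => h v = i).card : ℝ) ≤ m + ⌊10 * M⌋₊ := by
    exact_mod_cast h3 i hi
  linarith

end

/-! ### Spare vertices -/

section

variable {V : Type*} [Fintype V] [DecidableEq V]

/-- A set `S` of prescribed size that meets the edges of `E` in few vertices on average. The
vertices of `S` are chosen greedily, one after the other. -/
lemma exists_spread_set {n : ℕ} (E : Finset (Finset V)) (hE : ∀ A ∈ E, A.card ≤ n) {β : ℝ}
    (hβ : 1 ≤ β) (k : ℕ) (hk : 2 * k ≤ Fintype.card V) :
    ∃ S : Finset V, S.card = k ∧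
      ∑ A ∈ E, β ^ (A ∩ S).card ≤ E.card * (1 + 2 * β * n / Fintype.card V) ^ k := by
  induction k with
  | zero => exact ⟨∅, by simp, by simp⟩
  | succ k ih =>
    obtain ⟨S, hS, hΦ⟩ := ih (by omega)
    have hV : (0 : ℝ) < Fintype.card V := by
      have : 0 < Fintype.card V := by omega
      exact_mod_cast this
    have hSc : Sᶜ.card = Fintype.card V - k := by rw [card_compl, hS]
    have hScpos : 0 < Sᶜ.card := by omega
    have hhalf : (Fintype.card V : ℝ) ≤ 2 * Sᶜ.card := by
      have : Fintype.card V ≤ 2 * Sᶜ.card := by omega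
      exact_mod_cast this
    have hβ0 : 0 < β := by linarith
    set Φ := ∑ A ∈ E, β ^ (A ∩ S).card with hΦdef
    have hΦ0 : 0 ≤ Φ := Finset.sum_nonneg fun A _ => by positivity
    have hstep : ∀ A ∈ E, ∑ v ∈ Sᶜ, β ^ (A ∩ insert v S).card ≤
        β ^ (A ∩ S).card * (Sᶜ.card + β * n) := by
      intro A hA
      have h1 : ∀ v ∈ Sᶜ, β ^ (A ∩ insert v S).card ≤
          β ^ (A ∩ S).card * (1 + if v ∈ A then β else 0) := by
        intro v hv
        by_cases hvA : v ∈ A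
        · rw [if_pos hvA, inter_insert_of_mem hvA]
          calc β ^ (insert v (A ∩ S)).card ≤ β ^ ((A ∩ S).card + 1) :=
                pow_le_pow_right₀ hβ (card_insert_le _ _)
            _ = β ^ (A ∩ S).card * β := pow_succ _ _
            _ ≤ _ := by gcongr; linarith
        · rw [if_neg hvA, inter_insert_of_notMem hvA, add_zero, mul_one]
      refine (Finset.sum_le_sum h1).trans ?_
      rw [← Finset.mul_sum, Finset.sum_add_distrib, Finset.sum_const, nsmul_eq_mul, mul_one,
        ← Finset.sum_filter, Finset.sum_const, nsmul_eq_mul, mul_comm β]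
      gcongr
      exact (card_le_card fun v hv => (mem_filter.1 hv).2).trans (hE A hA)
    have htot : ∑ v ∈ Sᶜ, ∑ A ∈ E, β ^ (A ∩ insert v S).card ≤
        ∑ v ∈ Sᶜ, Φ * (1 + 2 * β * n / Fintype.card V) := by
      rw [Finset.sum_comm]
      refine (Finset.sum_le_sum hstep).trans ?_
      rw [← Finset.sum_mul, Finset.sum_const, nsmul_eq_mul]
      rw [show (Sᶜ.card : ℝ) * (Φ * (1 + 2 * β * n / Fintype.card V)) =
        Φ * (Sᶜ.card + β * n * ((2 * Sᶜ.card) / Fintype.card V)) by ring]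
      have hratio : (1 : ℝ) ≤ 2 * Sᶜ.card / Fintype.card V := by rwa [one_le_div hV]
      have hβn : β * n ≤ β * n * (2 * Sᶜ.card / Fintype.card V) :=
        le_mul_of_one_le_right (by positivity) hratio
      exact mul_le_mul_of_nonneg_left (by linarith) hΦ0
    obtain ⟨v, hv, hle⟩ := Finset.exists_le_of_sum_le (card_pos.1 hScpos) htot
    refine ⟨insert v S, ?_, hle.trans ?_⟩
    · rw [card_insert_of_notMem (mem_compl.1 hv), hS]
    · rw [pow_succ, ← mul_assoc]
      gcongr

/-- A partial colouring whose classes have at most `m` vertices extends to a colouring in which all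
`r` classes have exactly `m` vertices. -/
lemma exists_extension {r m : ℕ} (hV : Fintype.card V = r * m) (S : Finset V)
    (h : {v // v ∉ S} → Fin r) (hh : ∀ i, (univ.filter fun v => h v = i).card ≤ m) :
    ∃ c : V → Fin r, (∀ v (hv : v ∉ S), c v = h ⟨v, hv⟩) ∧
      ∀ i, (univ.filter fun v => c v = i).card = m := by
  have hsum : ∑ i, (univ.filter fun v => h v = i).card = Fintype.card {v // v ∉ S} := by
    rw [← card_univ, ← Finset.card_eq_sum_card_fiberwise]
    simp
  have hcompl : Fintype.card {v // v ∈ S} + Fintype.card {v // v ∉ S} = r * m := by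
    rw [← hV, Fintype.card_subtype_compl]
    exact Nat.add_sub_cancel' (Fintype.card_subtype_le _)
  have hcard : Fintype.card {v // v ∈ S} =
      Fintype.card (Σ i : Fin r, Fin (m - (univ.filter fun v => h v = i).card)) := by
    rw [Fintype.card_sigma]
    simp only [Fintype.card_fin]
    have h1 : ∑ i : Fin r, (m - (univ.filter fun v => h v = i).card) +
        ∑ i, (univ.filter fun v => h v = i).card = r * m := by
      rw [← Finset.sum_add_distrib, Finset.sum_congr rfl fun i _ => Nat.sub_add_cancel (hh i)]
      simp
    omega
  let ψ := Fintype.equivOfCardEq hcard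
  refine ⟨fun v => if hv : v ∈ S then (ψ ⟨v, hv⟩).1 else h ⟨v, hv⟩, fun v hv => dif_neg hv,
    fun i => ?_⟩
  set c : V → Fin r := fun v => if hv : v ∈ S then (ψ ⟨v, hv⟩).1 else h ⟨v, hv⟩ with hc
  have h1 : (univ.filter fun v : {v // v ∈ S} => (ψ v).1 = i).card =
      m - (univ.filter fun v => h v = i).card := by
    have : (univ.filter fun v : {v // v ∈ S} => (ψ v).1 = i) =
        (univ.map (Function.Embedding.sigmaMk (β := fun i : Fin r =>
          Fin (m - (univ.filter fun v => h v = i).card)) i)).map ψ.symm.toEmbedding := by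
      ext v
      simp only [mem_filter, mem_univ, true_and, mem_map, Function.Embedding.sigmaMk_apply,
        Equiv.coe_toEmbedding, exists_exists_eq_and]
      constructor
      · rintro rfl
        exact ⟨(ψ v).2, ψ.symm_apply_apply v⟩
      · rintro ⟨x, rfl⟩
        simp
    rw [this, card_map, card_map, card_univ, Fintype.card_fin]
  have h2 : (univ.filter fun v => c v = i) =
      ((univ.filter fun v : {v // v ∈ S} => (ψ v).1 = i).map (Function.Embedding.subtype _)) ∪
      ((univ.filter fun v : {v // v ∉ S} => h v = i).map (Function.Embedding.subtype _)) := by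
    ext v
    by_cases hv : v ∈ S <;> simp [hc, hv]
  rw [h2, card_union_of_disjoint, card_map, card_map, h1]
  · have := hh i; omega
  · rw [Finset.disjoint_left]
    intro v hv hv'
    simp only [mem_map, mem_filter, mem_univ, true_and, Function.Embedding.subtype_apply,
      Subtype.exists, exists_and_right, exists_eq_right] at hv hv'
    obtain ⟨hv1, -⟩ := hv
    obtain ⟨hv2, -⟩ := hv'
    exact hv2 hv1

/-- Equitable colouring when the classes are large. A spread set `S` of `r * s` vertices is left
out; the rest is coloured properly and almost equitably, and `S` makes up for the differences. -/
lemma exists_equitable_of_spread {r m s n κ g D : ℕ} (hr : 2 ≤ r) (hn : 0 < n) (hg : 0 < g)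
    (hκ : κ = D + 4 * (r - 1) * g) (hV : Fintype.card V = r * m) (hm : 0 < m)
    (hs : 12 * r * n * s ≤ m)
    (E : Finset (Finset V)) (hE : ∀ A ∈ E, A.card = n) {W M : ℝ} (hM : 0 < M)
    (hW : 2 * (E.card : ℝ) / (r : ℝ) ^ n ≤ W) (hMs : 10 * M ≤ s)
    (hfull : ∀ l < r, r * (W ^ (l + 1) * (36 * r ^ 2 * g / κ) ^ l *
      Real.exp (n * ((l + 1) - 4 * (r - 1 - l) * g) / κ)) ≤ 1 / 40 * (1 / 5) ^ l)
    (hpart : ∀ l < r, r * (W ^ (l + 1) * (36 * r ^ 2 * g / κ) ^ l *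
      Real.exp (n * (2 * g + (l + 1)) / κ)) ≤ M * (1 / 5) ^ l)
    (hdev : 4 * (r * κ) ^ 2 ≤ m * g ^ 2) :
    ∃ c : V → Fin r, (∀ A ∈ E, ∀ i, ∃ v ∈ A, c v ≠ i) ∧
      ∀ i, (univ.filter fun v => c v = i).card = m := by
  have hrR : (0 : ℝ) < r := by positivity
  have hmR : (0 : ℝ) < m := by positivity
  have h2s : 2 * s ≤ m := by
    refine le_trans ?_ hs
    have : 0 < r * n := by positivity
    nlinarith [Nat.zero_le s]
  obtain ⟨S, hS, hΦ⟩ := exists_spread_set E (fun A hA => (hE A hA).le) (β := 3 * r)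
    (by have : (2 : ℝ) ≤ r := by exact_mod_cast hr
        linarith) (r * s) (by rw [hV]; nlinarith)
  have hpow : (1 + 2 * (3 * r) * n / Fintype.card V : ℝ) ^ (r * s) ≤ 2 := by
    have h1 : (1 + 2 * (3 * r) * n / Fintype.card V : ℝ) ≤ Real.exp (6 * n / m) := by
      rw [add_comm, hV]
      refine le_trans (le_of_eq ?_) (Real.add_one_le_exp _)
      push_cast
      field_simp
      ring
    calc _ ≤ Real.exp (6 * n / m) ^ (r * s) := by gcongr
      _ = Real.exp ((r * s : ℕ) * (6 * n / m)) := (Real.exp_nat_mul _ _).symm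
      _ ≤ Real.exp (1 / 2) := by
          apply Real.exp_le_exp.2
          have : (12 * r * n * s : ℝ) ≤ m := by exact_mod_cast hs
          push_cast
          rw [mul_div_assoc', div_le_iff₀ hmR]
          linarith
      _ ≤ 2 := by
          have h3 := Real.exp_one_lt_three
          have h4 : Real.exp (1 / 2) ^ 2 = Real.exp 1 := by
            rw [← Real.exp_nat_mul]; norm_num
          nlinarith [Real.exp_pos (1 / 2)]
  have hΦ2 : ∑ A ∈ E, (3 * r : ℝ) ^ (A ∩ S).card ≤ 2 * E.card := by
    refine hΦ.trans ?_
    rw [mul_comm]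
    gcongr
  have hV' : Fintype.card {v // v ∉ S} = r * (m - s) := by
    rw [Fintype.card_subtype_compl, Fintype.card_coe, hS, hV, Nat.mul_sub]
  set E' : Finset (Finset {v // v ∉ S}) := E.image fun A => A.subtype fun v => v ∉ S with hE'
  have hcardA : ∀ A ∈ E, (A.subtype fun v => v ∉ S).card + (A ∩ S).card = n := by
    intro A hA
    rw [card_subtype, ← hE A hA, add_comm, ← filter_mem_eq_inter]
    exact card_filter_add_card_filter_not _
  have hE'card : ∀ A ∈ E', A.card ≤ n := by
    intro B hB
    obtain ⟨A, hA, rfl⟩ := mem_image.1 hB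
    have := hcardA A hA
    omega
  have hW' : ∑ A ∈ E', weight n r A ≤ W := by
    refine le_trans ?_ hW
    refine (Finset.sum_image_le_of_nonneg (fun A _ => weight_nonneg _ _ _)).trans ?_
    have : ∀ A ∈ E, weight n r (A.subtype fun v => v ∉ S) =
        (3 * r : ℝ) ^ (A ∩ S).card / (r : ℝ) ^ n := by
      intro A hA
      have := hcardA A hA
      rw [weight]
      congr 2
      omega
    rw [Finset.sum_congr rfl this, ← Finset.sum_div]
    gcongr
  obtain ⟨h, h1, h2, h3⟩ := exists_almost_equitable hr (m := m - s) (by omega) hg hκ hV' E' hE'card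
    hW' hM hfull hpart (by
      have : m ≤ 2 * (m - s) := by omega
      have := Nat.mul_le_mul_right (g ^ 2) this
      rw [mul_assoc] at this
      omega)
  obtain ⟨c, hc1, hc2⟩ := exists_extension hV S (fun v => ⟨h v, h1 v⟩) (fun i => by
    have h4 := h3 i i.2
    have h5 : (univ.filter fun v => (⟨h v, h1 v⟩ : Fin r) = i) =
        univ.filter fun v => h v = i := by
      ext v; simp [Fin.ext_iff]
    rw [h5]
    rw [Nat.cast_sub (by omega)] at h4
    have h6 : ((univ.filter fun v => h v = i).card : ℝ) ≤ m := by linarith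
    exact_mod_cast h6)
  refine ⟨c, fun A hA i => ?_, hc2⟩
  obtain ⟨v, hv, hne⟩ := h2 _ (mem_image_of_mem _ hA) i
  refine ⟨v, mem_subtype.1 hv, fun heq => hne ?_⟩
  rw [hc1 v v.2] at heq
  exact congrArg Fin.val heq

end

/-! ### Random equitable colourings -/

section

variable {V : Type*} [Fintype V] [DecidableEq V]

/-- The number of permutations that map a given set of `n` vertices into `T`. -/
lemma card_perm_mapsTo (T A : Finset V) :
    (univ.filter fun σ : Equiv.Perm V => ∀ v ∈ A, σ v ∈ T).card * (Fintype.card V).choose A.card =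
      (Fintype.card V).factorial * T.card.choose A.card := by
  have hconst : ∀ B ∈ powersetCard A.card (univ : Finset V),
      (univ.filter fun σ : Equiv.Perm V => ∀ v ∈ B, σ v ∈ T).card =
      (univ.filter fun σ : Equiv.Perm V => ∀ v ∈ A, σ v ∈ T).card := by
    intro B hB
    have hcard : B.card = A.card := (mem_powersetCard.1 hB).2
    let ε : {v // v ∈ A} ≃ {v // v ∈ B} := Fintype.equivOfCardEq (by simp [hcard])
    let τ : Equiv.Perm V := ε.extendSubtype
    have hτ : ∀ v, v ∈ A ↔ τ v ∈ B := by
      intro v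
      constructor
      · intro hv; exact ε.extendSubtype_mem v hv
      · intro hv
        by_contra hvA
        exact ε.extendSubtype_not_mem v hvA hv
    refine Finset.card_bij' (fun σ _ => σ * τ) (fun σ _ => σ * τ⁻¹) ?_ ?_ ?_ ?_
    · intro σ hσ
      simp only [mem_filter, mem_univ, true_and, Equiv.Perm.mul_apply] at hσ ⊢
      exact fun v hv => hσ _ ((hτ v).1 hv)
    · intro σ hσ
      simp only [mem_filter, mem_univ, true_and, Equiv.Perm.mul_apply] at hσ ⊢
      refine fun v hv => hσ _ ((hτ _).2 ?_)
      simpa using hv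
    · intro σ _; simp
    · intro σ _; simp
  have hsum : ∑ B ∈ powersetCard A.card (univ : Finset V),
      (univ.filter fun σ : Equiv.Perm V => ∀ v ∈ B, σ v ∈ T).card =
      ∑ σ : Equiv.Perm V, T.card.choose A.card := by
    simp_rw [card_eq_sum_ones, sum_filter]
    rw [Finset.sum_comm]
    refine Finset.sum_congr rfl fun σ _ => ?_
    rw [← sum_filter, ← card_eq_sum_ones, ← card_eq_sum_ones, ← card_eq_sum_ones]
    have : ((powersetCard A.card univ).filter fun B => ∀ v ∈ B, σ v ∈ T) =
        powersetCard A.card (T.map σ.symm.toEmbedding) := by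
      ext B
      simp only [mem_filter, mem_powersetCard, subset_univ, true_and]
      rw [and_comm]
      refine and_congr_left fun _ => forall₂_congr fun v _ => ?_
      simp [mem_map_equiv]
    rw [this, card_powersetCard, card_map]
  rw [Finset.sum_congr rfl hconst, Finset.sum_const, card_powersetCard, card_univ, Finset.sum_const,
    card_univ, Fintype.card_perm, smul_eq_mul, smul_eq_mul] at hsum
  rw [mul_comm, hsum]

/-- If a random colouring with classes of size `m` is expected to have less than one monochromatic
edge, there is a proper one. -/
lemma exists_equitable_of_choose {r m n : ℕ} (hV : Fintype.card V = r * m)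
    (E : Finset (Finset V)) (hE : ∀ A ∈ E, A.card = n)
    (hlt : E.Nonempty → r * E.card * m.choose n < (r * m).choose n) :
    ∃ c : V → Fin r, (∀ A ∈ E, ∀ i, ∃ v ∈ A, c v ≠ i) ∧
      ∀ i, (univ.filter fun v => c v = i).card = m := by
  let φ : V ≃ Fin r × Fin m := Fintype.equivOfCardEq (by simp [hV])
  have hfib : ∀ i, (univ.filter fun v => (φ v).1 = i).card = m := by
    intro i
    have : (univ.filter fun v => (φ v).1 = i) =
        (({i} : Finset (Fin r)) ×ˢ (univ : Finset (Fin m))).map φ.symm.toEmbedding := by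
      ext v
      simp only [mem_filter, mem_univ, true_and, mem_map_equiv, Equiv.symm_symm, mem_product,
        mem_singleton, and_true]
    rw [this, card_map, card_product]
    simp
  obtain ⟨σ, hσ⟩ : ∃ σ : Equiv.Perm V, ∀ A ∈ E, ∀ i, ∃ v ∈ A, (φ (σ v)).1 ≠ i := by
    rcases E.eq_empty_or_nonempty with rfl | hne
    · exact ⟨1, by simp⟩
    by_contra hcon
    push Not at hcon
    have hcover : (univ : Finset (Equiv.Perm V)) ⊆ (E ×ˢ (univ : Finset (Fin r))).biUnion fun p =>
        univ.filter fun σ : Equiv.Perm V => ∀ v ∈ p.1, σ v ∈ univ.filter fun v => (φ v).1 = p.2 := by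
      intro σ _
      obtain ⟨A, hA, i, h⟩ := hcon σ
      simp only [mem_biUnion, mem_product, mem_univ, and_true, mem_filter, true_and]
      exact ⟨(A, i), hA, h⟩
    have h1 := (card_le_card hcover).trans card_biUnion_le
    rw [card_univ, Fintype.card_perm] at h1
    have h2 := Nat.mul_le_mul_right ((r * m).choose n) h1
    rw [Finset.sum_mul] at h2
    have h3 : ∀ p ∈ E ×ˢ (univ : Finset (Fin r)), (univ.filter fun σ : Equiv.Perm V =>
        ∀ v ∈ p.1, σ v ∈ univ.filter fun v => (φ v).1 = p.2).card * (r * m).choose n =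
        (Fintype.card V).factorial * m.choose n := by
      intro p hp
      have := card_perm_mapsTo (univ.filter fun v => (φ v).1 = p.2) p.1
      rw [hfib, hE p.1 (mem_product.1 hp).1, hV] at this
      rw [hV]
      exact this
    rw [Finset.sum_congr rfl h3, Finset.sum_const, card_product, card_univ, Fintype.card_fin,
      smul_eq_mul] at h2
    have h4 := hlt hne
    have h5 := Nat.factorial_pos (Fintype.card V)
    have h6 := Nat.mul_lt_mul_of_pos_left h4 h5
    nlinarith
  refine ⟨fun v => (φ (σ v)).1, hσ, fun i => ?_⟩
  refine (Finset.card_bij' (t := univ.filter fun v => (φ v).1 = i) (fun v _ => σ v)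
    (fun v _ => σ.symm v) ?_ ?_ ?_ ?_).trans (hfib i) <;> simp

/-- Comparison of the number of `n`-sets inside a class of size `m` with the number of all `n`-sets.
The exponential gain comes from drawing without replacement. -/
lemma choose_mul_exp_le {r m n : ℕ} (hr : 1 ≤ r) (hnm : n ≤ m) (hm : 0 < m) :
    (m.choose n : ℝ) * (r : ℝ) ^ n * Real.exp ((1 - 1 / r) * (n * (n - 1)) / (2 * m)) ≤
      (r * m).choose n := by
  have hrR : (1 : ℝ) ≤ r := by exact_mod_cast hr
  have hmR : (0 : ℝ) < m := by positivity
  have hfac : (0 : ℝ) < n.factorial := by positivity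
  rw [← mul_le_mul_iff_right₀ hfac]
  have e1 : (n.factorial : ℝ) * m.choose n = ∏ i ∈ range n, ((m : ℝ) - i) := by
    rw [← Nat.cast_mul, ← Nat.descFactorial_eq_factorial_mul_choose,
      Nat.descFactorial_eq_prod_range]
    push_cast
    exact Finset.prod_congr rfl fun i hi => Nat.cast_sub (by have := mem_range.1 hi; omega)
  have e2 : (n.factorial : ℝ) * (r * m).choose n = ∏ i ∈ range n, ((r : ℝ) * m - i) := by
    rw [← Nat.cast_mul, ← Nat.descFactorial_eq_factorial_mul_choose,
      Nat.descFactorial_eq_prod_range]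
    push_cast
    refine Finset.prod_congr rfl fun i hi => ?_
    rw [Nat.cast_sub]
    · push_cast; ring
    · have := mem_range.1 hi
      nlinarith
  have e3 : Real.exp ((1 - 1 / r) * (n * (n - 1)) / (2 * m)) =
      ∏ i ∈ range n, Real.exp ((1 - 1 / r) * i / m) := by
    rw [← Real.exp_sum, ← Finset.sum_div, ← Finset.mul_sum]
    congr 1
    have : (∑ i ∈ range n, (i : ℝ)) = n * (n - 1) / 2 := by
      clear * -
      induction n with
      | zero => simp
      | succ n ih => rw [Finset.sum_range_succ, ih]; push_cast; ring
    rw [this]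
    field_simp
  rw [e2, ← mul_assoc, ← mul_assoc, e1, e3, ← card_range n, ← Finset.prod_const, card_range,
    ← Finset.prod_mul_distrib, ← Finset.prod_mul_distrib]
  have hlt : ∀ i ∈ range n, (i : ℝ) < m := fun i hi => by
    have := mem_range.1 hi
    exact_mod_cast this.trans_le hnm
  refine Finset.prod_le_prod (fun i hi => ?_) fun i hi => ?_
  · have := hlt i hi
    have : (0 : ℝ) < m - i := by linarith
    positivity
  · have hi' := hlt i hi
    set x : ℝ := (1 - 1 / r) * i / m with hx
    have h1 : (1 - x) * Real.exp x ≤ 1 := by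
      have := Real.add_one_le_exp (-x)
      rw [Real.exp_neg] at this
      rw [← le_div_iff₀ (Real.exp_pos x), one_div]
      linarith
    have hi0 : (0 : ℝ) ≤ i := Nat.cast_nonneg i
    have h2 : (m - i) * r ≤ (r * m - i) * (1 - x) := by
      have : (r * m - i) * (1 - x) - (m - i) * r = (r - 1) * i ^ 2 / (r * m) := by
        rw [hx]; field_simp; ring
      have h3 : 0 ≤ (r - 1) * (i : ℝ) ^ 2 / (r * m) := by
        have : (0 : ℝ) ≤ r - 1 := by linarith
        positivity
      linarith
    have h3 : (0 : ℝ) ≤ r * m - i := by nlinarith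
    calc (m - i) * r * Real.exp x ≤ (r * m - i) * (1 - x) * Real.exp x := by gcongr
      _ = (r * m - i) * ((1 - x) * Real.exp x) := by ring
      _ ≤ (r * m - i) * 1 := by gcongr
      _ = _ := mul_one _

end

/-! ### Small colour classes -/

section

/-- The conditions on the size parameter `n`, with `L = log n`, under which all estimates hold. -/
structure IsLarge (n : ℕ) (L : ℝ) : Prop where
  exp_eq : Real.exp L = n
  le_L : (400 : ℝ) ^ 5 ≤ L
  L_le : L ^ 3 ≤ n

lemma exists_isLarge : ∃ N : ℕ, ∀ n : ℕ, N ≤ n → IsLarge n (Real.log n) := by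
  have h1 : Filter.Tendsto (fun n : ℕ => Real.log n) Filter.atTop Filter.atTop :=
    Real.tendsto_log_atTop.comp tendsto_natCast_atTop_atTop
  have h2 := (Real.isLittleO_pow_log_id_atTop (n := 3)).bound (c := 1) one_pos
  have h3 := (tendsto_natCast_atTop_atTop (R := ℝ)).eventually h2
  obtain ⟨N, hN⟩ := Filter.eventually_atTop.1
    ((h1.eventually_ge_atTop ((400 : ℝ) ^ 5)).and (h3.and (Filter.eventually_gt_atTop 0)))
  refine ⟨N, fun n hn => ?_⟩
  obtain ⟨h4, h5, h6⟩ := hN n hn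
  refine ⟨Real.exp_log (by exact_mod_cast h6), h4, ?_⟩
  have h7 : (0 : ℝ) ≤ Real.log n := by
    have : (0 : ℝ) ≤ 400 ^ 5 := by positivity
    linarith
  simpa [abs_of_nonneg h7] using h5

lemma pow_le_of_pow_lt {r : ℕ} {L : ℝ} (hL : (400 : ℝ) ^ 5 ≤ L) (hrL : (r : ℝ) ^ 5 < L) :
    400 * (r : ℝ) ^ 4 ≤ L := by
  rcases le_total (400 : ℝ) r with h | h
  · refine le_trans ?_ hrL.le
    rw [pow_succ' (r : ℝ) 4]
    gcongr
  · refine le_trans ?_ hL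
    rw [pow_succ' (400 : ℝ) 4]
    gcongr

variable {n r : ℕ} {L : ℝ}

namespace IsLarge

lemma pos (h : IsLarge n L) : 0 < L := lt_of_lt_of_le (by positivity) h.le_L

lemma one_le (h : IsLarge n L) : 1 ≤ L := le_trans (by norm_num) h.le_L

end IsLarge

/-- The saving of random equitable colourings suffices for classes of size at most about
`n ^ 2 / (2 * log n)`. -/
lemma choose_lt_of_small {m E : ℕ} (h : IsLarge n L) (hr : 2 ≤ r)
    (hE : (E : ℝ) ≤ 0.01 * (n / L) ^ (((r : ℝ) - 1) / r) * (r : ℝ) ^ (n - 1))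
    (hm : 2 * m * L ≤ n * (n - 1)) (hnm : n ≤ r * m) :
    r * E * m.choose n < (r * m).choose n := by
  have hL := h.one_le
  have hn : (0 : ℝ) < n := h.exp_eq ▸ Real.exp_pos L
  have hn' : 0 < n := by exact_mod_cast hn
  rcases Nat.lt_or_ge m n with hlt | hnm'
  · rw [Nat.choose_eq_zero_of_lt hlt, Nat.mul_zero]
    exact Nat.choose_pos hnm
  have hm0 : 0 < m := by omega
  have hmR : (0 : ℝ) < m := by exact_mod_cast hm0
  have hrR : (2 : ℝ) ≤ r := by exact_mod_cast hr
  have key := choose_mul_exp_le (r := r) (by omega) hnm' hm0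
  have hCpos : (0 : ℝ) < m.choose n := by exact_mod_cast Nat.choose_pos hnm'
  have hq : ((n : ℝ) / L) ^ (((r : ℝ) - 1) / r) ≤
      Real.exp ((1 - 1 / r) * (n * (n - 1)) / (2 * m)) := by
    have h1 : ((n : ℝ) / L) ^ (((r : ℝ) - 1) / r) ≤ (n : ℝ) ^ (((r : ℝ) - 1) / r) := by
      apply Real.rpow_le_rpow (by positivity)
      · exact div_le_self hn.le hL
      · apply div_nonneg <;> linarith
    refine h1.trans ?_
    rw [← h.exp_eq, ← Real.exp_mul, h.exp_eq]
    apply Real.exp_le_exp.2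
    have h2 : L ≤ n * (n - 1) / (2 * m) := by
      rw [le_div_iff₀ (by positivity)]; linarith
    have h3 : ((r : ℝ) - 1) / r = 1 - 1 / r := by field_simp
    rw [h3, mul_div_assoc, mul_comm]
    gcongr
    rw [sub_nonneg, div_le_one (by linarith)]; linarith
  have hpow : (r : ℝ) ^ n = r ^ (n - 1) * r := by rw [← pow_succ, Nat.sub_add_cancel hn']
  have hexp := Real.exp_pos ((1 - 1 / r) * (n * (n - 1)) / (2 * m))
  have hfin : ((r * E * m.choose n : ℕ) : ℝ) < (r * m).choose n := by
    refine lt_of_lt_of_le ?_ key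
    push_cast
    calc (r : ℝ) * E * m.choose n
        ≤ r * (0.01 * Real.exp ((1 - 1 / r) * (n * (n - 1)) / (2 * m)) * (r : ℝ) ^ (n - 1)) *
          m.choose n := by
          gcongr
          exact hE.trans (by gcongr)
      _ = 0.01 * (m.choose n * (r : ℝ) ^ n *
          Real.exp ((1 - 1 / r) * (n * (n - 1)) / (2 * m))) := by rw [hpow]; ring
      _ < _ := by
          have : 0 < (m.choose n * (r : ℝ) ^ n *
            Real.exp ((1 - 1 / r) * (n * (n - 1)) / (2 * m))) := by positivity
          linarith
  exact_mod_cast hfin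

end

/-! ### Large colour classes -/

section

variable {n r : ℕ} {L : ℝ}

/-- The common length `κ` of the default intervals, when every interval `[lo i, hi i)` has length
`2 * n` and the bands have length `4 * r * n`. With total length `r * κ`, each band then makes up the
fraction `4 * n / κ` of the line, which is about `log n / (r * n)`. -/
noncomputable def blockLength (n r : ℕ) (L : ℝ) : ℕ := ⌈4 * r * n ^ 2 / L⌉₊


lemma IsLarge.n_pos (h : IsLarge n L) : (0 : ℝ) < n := h.exp_eq ▸ Real.exp_pos L

lemma le_blockLength (h : IsLarge n L) : 4 * r * n ^ 2 ≤ blockLength n r L * L := by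
  rw [← div_le_iff₀ h.pos]
  exact Nat.le_ceil _

lemma blockLength_le (h : IsLarge n L) : (blockLength n r L : ℝ) ≤ 4 * r * n ^ 2 / L + 1 := by
  have := h.pos
  exact (Nat.ceil_lt_add_one (by positivity)).le

lemma blockLength_pos (h : IsLarge n L) (hr : 2 ≤ r) : (0 : ℝ) < blockLength n r L := by
  have h1 := le_blockLength (r := r) h
  have h2 := h.n_pos
  have h3 : (0 : ℝ) < r := by positivity
  have h4 : 0 < 4 * r * (n : ℝ) ^ 2 := by positivity
  exact pos_of_mul_pos_left (h4.trans_le h1) h.pos.le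

lemma exists_blockLength_eq (h : IsLarge n L) (hr : 2 ≤ r) :
    ∃ D, blockLength n r L = D + 4 * (r - 1) * n := by
  have h1 := le_blockLength (r := r) h
  have hL := h.one_le
  have hn := h.n_pos
  have hLn : L ≤ n := (le_self_pow₀ hL (by norm_num)).trans h.L_le
  have h2 : (4 * (r - 1) * n : ℝ) ≤ blockLength n r L := by
    refine le_of_mul_le_mul_right ?_ h.pos
    refine le_trans ?_ h1
    have hrR : (2 : ℝ) ≤ r := by exact_mod_cast hr
    calc (4 * (r - 1) * n : ℝ) * L ≤ 4 * r * n * n := by gcongr; linarith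
      _ = _ := by ring
  have h3 : 4 * (r - 1) * n ≤ blockLength n r L := by
    have : ((4 * (r - 1) * n : ℕ) : ℝ) ≤ blockLength n r L := by
      push_cast [Nat.cast_sub (show 1 ≤ r by omega)]
      exact h2
    exact_mod_cast this
  exact ⟨blockLength n r L - 4 * (r - 1) * n, by omega⟩

lemma sq_div_blockLength_le (h : IsLarge n L) (hr : 2 ≤ r) :
    4 * (n : ℝ) ^ 2 / blockLength n r L ≤ L / r := by
  have hrR : (0 : ℝ) < r := by positivity
  rw [div_le_div_iff₀ (blockLength_pos h hr) hrR]
  have := le_blockLength (r := r) h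
  linarith

lemma le_sq_div_blockLength (h : IsLarge n L) (hr : 2 ≤ r) :
    (L - Real.log L) / r ≤ 4 * (n : ℝ) ^ 2 / blockLength n r L := by
  have hrR : (2 : ℝ) ≤ r := by exact_mod_cast hr
  have hL := h.pos
  have hlog : 1 ≤ Real.log L := by
    rw [Real.le_log_iff_exp_le hL]
    have h1 := h.le_L
    have h2 := Real.exp_one_lt_three
    norm_num at h1
    linarith
  have hlogL : Real.log L ≤ L := Real.log_le_self hL.le
  have hLn : L ^ 2 ≤ (n : ℝ) ^ 2 := by
    have : L ≤ n := (le_self_pow₀ h.one_le (by norm_num)).trans h.L_le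
    gcongr
  rw [div_le_div_iff₀ (by linarith) (blockLength_pos h hr)]
  calc (L - Real.log L) * blockLength n r L ≤ (L - Real.log L) * (4 * r * n ^ 2 / L + 1) := by
        gcongr
        exact blockLength_le h
    _ ≤ 4 * n ^ 2 * r := by
        have h3 : (L - Real.log L) * (4 * r * n ^ 2 / L + 1) =
            4 * n ^ 2 * r - (Real.log L * (4 * r * n ^ 2) / L - (L - Real.log L)) := by
          field_simp
          ring
        have h4 : L ≤ Real.log L * (4 * r * n ^ 2) / L := by
          rw [le_div_iff₀ hL]
          calc L * L ≤ 1 * (1 * (n : ℝ) ^ 2) := by linarith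
            _ ≤ Real.log L * (4 * r * n ^ 2) := by gcongr; linarith
        linarith

lemma div_blockLength_le (h : IsLarge n L) (hr : 2 ≤ r) :
    (n : ℝ) / blockLength n r L ≤ 1 / 100 := by
  have hrR : (2 : ℝ) ≤ r := by exact_mod_cast hr
  have h1 := sq_div_blockLength_le h hr
  have hn := h.n_pos
  have hκ := blockLength_pos h hr
  have hL := h.one_le
  have hLn : 400 * L ≤ n := by
    refine le_trans ?_ h.L_le
    have : (400 : ℝ) ≤ L := le_trans (by norm_num) h.le_L
    calc 400 * L ≤ L * L := by gcongr
      _ ≤ L ^ 3 := by nlinarith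
  have h2 : L / r ≤ L := div_le_self (by linarith) (by linarith)
  have h3 : 4 * (n : ℝ) ^ 2 ≤ L * blockLength n r L := (div_le_iff₀ hκ).1 (h1.trans h2)
  rw [div_le_div_iff₀ hκ (by norm_num)]
  nlinarith

lemma exp_hundredth_le : Real.exp (1 / 100) ≤ 1.1 := by
  have := Real.add_one_le_exp (-(1 / 100 : ℝ))
  rw [Real.exp_neg] at this
  have h2 := Real.exp_pos (1 / 100 : ℝ)
  have h3 := mul_inv_cancel₀ h2.ne'
  nlinarith

/-- The `r`-th root of `n / log n`. -/
noncomputable def root (r : ℕ) (L : ℝ) : ℝ := Real.exp ((L - Real.log L) / r)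

lemma one_le_root (h : IsLarge n L) : 1 ≤ root r L := by
  apply Real.one_le_exp
  have := Real.log_le_self h.pos.le
  apply div_nonneg _ (Nat.cast_nonneg r)
  linarith

lemma root_pow (h : IsLarge n L) (hr : 2 ≤ r) : root r L ^ r = n / L := by
  have hrR : (0 : ℝ) < r := by positivity
  rw [root, ← Real.exp_nat_mul, mul_div_cancel₀ _ hrR.ne', Real.exp_sub, h.exp_eq,
    Real.exp_log h.pos]

lemma rpow_eq_root_pow (h : IsLarge n L) (hr : 2 ≤ r) :
    ((n : ℝ) / L) ^ (((r : ℝ) - 1) / r) = root r L ^ (r - 1) := by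
  have h1 := one_le_root (r := r) h
  have hrR : (0 : ℝ) < r := by positivity
  rw [← root_pow h hr, ← Real.rpow_natCast, ← Real.rpow_mul (by linarith), ← Real.rpow_natCast]
  congr 1
  rw [Nat.cast_sub (by omega)]
  field_simp
  simp

/-- The factor contributed to the expected number of chains by one more edge and one more link. -/
lemma weight_mul_link_le (h : IsLarge n L) (hr : 2 ≤ r) :
    0.02 * root r L ^ (r - 1) / r * (36 * r ^ 2 * n / blockLength n r L) ≤ 0.18 / root r L := by
  have h1 := one_le_root (r := r) h
  have hrR : (0 : ℝ) < r := by positivity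
  have hn := h.n_pos
  have hL := h.pos
  have hκ := blockLength_pos h hr
  have h2 : 36 * r ^ 2 * n / blockLength n r L ≤ 9 * r / (n / L) := by
    rw [div_div_eq_mul_div, div_le_div_iff₀ hκ hn]
    have := le_blockLength (r := r) h
    nlinarith
  calc _ ≤ 0.02 * root r L ^ (r - 1) / r * (9 * r / (n / L)) := by gcongr
    _ = 0.18 * root r L ^ (r - 1) / root r L ^ r := by
        rw [← root_pow h hr]
        field_simp
        norm_num
    _ = 0.18 / root r L := by
        obtain ⟨t, rfl⟩ : ∃ t, r = t + 1 := ⟨r - 1, by omega⟩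
        rw [Nat.add_sub_cancel, pow_succ]
        field_simp

lemma chain_weight_le (h : IsLarge n L) (hr : 2 ≤ r) (l : ℕ) {x : ℝ} (hx : 0 ≤ x) :
    r * ((0.02 * root r L ^ (r - 1) / r) ^ (l + 1) *
      (36 * r ^ 2 * n / blockLength n r L) ^ l * x) ≤
      0.02 * root r L ^ (r - 1) * (0.18 / root r L) ^ l * x := by
  have h1 := one_le_root (r := r) h
  have hrR : (0 : ℝ) < r := by positivity
  have hκ := blockLength_pos h hr
  set W := 0.02 * root r L ^ (r - 1) / r with hW
  have h2 : r * W = 0.02 * root r L ^ (r - 1) := by rw [hW]; field_simp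
  calc _ = r * W * (W * (36 * r ^ 2 * n / blockLength n r L)) ^ l * x := by
        rw [mul_pow]; ring
    _ ≤ _ := by
        rw [h2]
        gcongr
        exact weight_mul_link_le h hr

/-- Summed over the `r` possible starting colours, the expected number of chains of `l + 1` edges from
the start of a block to the end of a block. The powers of `root r L` cancel exactly: this is where the
exponent `(r - 1) / r` of the theorem comes from. -/
lemma full_chain_le (h : IsLarge n L) (hr : 2 ≤ r) {l : ℕ} (hl : l < r) :
    r * ((0.02 * root r L ^ (r - 1) / r) ^ (l + 1) *
      (36 * r ^ 2 * n / blockLength n r L) ^ l *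
      Real.exp (n * ((l + 1) - 4 * (r - 1 - l) * n) / blockLength n r L)) ≤
      1 / 40 * (1 / 5) ^ l := by
  have h1 := one_le_root (r := r) h
  have h0 : 0 < root r L := by linarith
  have hκ := blockLength_pos h hr
  obtain ⟨t, rfl⟩ : ∃ t, r = l + 1 + t := ⟨r - (l + 1), by omega⟩
  set a := root (l + 1 + t) L with ha
  have hexp : Real.exp (n * ((l + 1) - 4 * (((l + 1 + t : ℕ) : ℝ) - 1 - l) * n) /
      blockLength n (l + 1 + t) L) ≤ 1.1 ^ (l + 1) / a ^ t := by
    have e1 : n * ((l + 1) - 4 * (((l + 1 + t : ℕ) : ℝ) - 1 - l) * n) /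
        blockLength n (l + 1 + t) L = (l + 1 : ℕ) * (n / blockLength n (l + 1 + t) L) -
          t * (4 * n ^ 2 / blockLength n (l + 1 + t) L) := by
      push_cast
      field_simp
      ring
    have e2 : a ^ t = Real.exp (t * ((L - Real.log L) / (l + 1 + t : ℕ))) := by
      rw [ha, root, ← Real.exp_nat_mul]
    rw [e1, Real.exp_sub, e2]
    refine div_le_div₀ (by positivity) ?_ (Real.exp_pos _) (Real.exp_le_exp.2 ?_)
    · rw [Real.exp_nat_mul]
      gcongr
      exact (Real.exp_le_exp.2 (div_blockLength_le h hr)).trans exp_hundredth_le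
    · exact mul_le_mul_of_nonneg_left (le_sq_div_blockLength h hr) (Nat.cast_nonneg t)
  refine (chain_weight_le h hr l (Real.exp_pos _).le).trans ?_
  rw [← ha]
  calc _ ≤ 0.02 * a ^ (l + 1 + t - 1) * (0.18 / a) ^ l * (1.1 ^ (l + 1) / a ^ t) := by gcongr
    _ = 0.022 * 0.198 ^ l := by
        rw [show l + 1 + t - 1 = l + t by omega, pow_add, div_pow, pow_succ,
          show (0.198 : ℝ) = 0.18 * 1.1 by norm_num, mul_pow]
        field_simp
        norm_num
    _ ≤ _ := by gcongr <;> norm_num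

/-- Summed over the `r` possible starting colours, the expected number of chains of `l + 1` edges
between default thresholds. Without the slack of `n` at either end the windows would have the exact
total length of the colour classes; the slack costs the factor `exp (L / (2 * r))`. -/
lemma default_chain_le (h : IsLarge n L) (hr : 2 ≤ r) (l : ℕ) :
    r * ((0.02 * root r L ^ (r - 1) / r) ^ (l + 1) *
      (36 * r ^ 2 * n / blockLength n r L) ^ l *
      Real.exp (n * (2 * n + (l + 1)) / blockLength n r L)) ≤
      (1 / 40 * root r L ^ (r - 1) * Real.exp (L / (2 * r))) * (1 / 5) ^ l := by
  have h1 := one_le_root (r := r) h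
  have h0 : 0 < root r L := by linarith
  have hκ := blockLength_pos h hr
  have hrR : (0 : ℝ) < r := by positivity
  have hexp : Real.exp (n * (2 * n + (l + 1)) / blockLength n r L) ≤
      1.1 ^ (l + 1) * Real.exp (L / (2 * r)) := by
    have e1 : (n * (2 * n + (l + 1)) / blockLength n r L : ℝ) =
        (l + 1 : ℕ) * (n / blockLength n r L) + (4 * n ^ 2 / blockLength n r L) / 2 := by
      push_cast
      field_simp
      ring
    have e2 : L / (2 * r) = L / r / 2 := by field_simp
    rw [e1, e2, Real.exp_add, Real.exp_nat_mul]
    refine mul_le_mul ?_ (Real.exp_le_exp.2 ?_) (Real.exp_pos _).le (by positivity)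
    · exact pow_le_pow_left₀ (Real.exp_pos _).le
        ((Real.exp_le_exp.2 (div_blockLength_le h hr)).trans exp_hundredth_le) _
    · have := sq_div_blockLength_le h hr
      linarith
  refine (chain_weight_le h hr l (Real.exp_pos _).le).trans ?_
  calc _ ≤ 0.02 * root r L ^ (r - 1) * (0.18 / 1) ^ l *
        (1.1 ^ (l + 1) * Real.exp (L / (2 * r))) := by gcongr
    _ = (0.022 * root r L ^ (r - 1) * Real.exp (L / (2 * r))) * 0.198 ^ l := by
        rw [show (0.198 : ℝ) = 0.18 / 1 * 1.1 by norm_num, mul_pow, pow_succ]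
        ring
    _ ≤ _ := by gcongr <;> norm_num

/-- The number of recoloured vertices is smaller, by a factor of about `n ^ (1 / (2 * r))`, than the
number of spare vertices. -/
lemma default_chain_bound_le (h : IsLarge n L) (hr : 2 ≤ r) (hrL : (r : ℝ) ^ 5 < L) :
    10 * (1 / 40 * root r L ^ (r - 1) * Real.exp (L / (2 * r))) ≤ n / (48 * r * L) - 1 := by
  have h1 := one_le_root (r := r) h
  have h0 : 0 < root r L := by linarith
  have hrR : (2 : ℝ) ≤ r := by exact_mod_cast hr
  have hL := h.pos
  have hL1 := h.one_le
  have hn := h.n_pos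
  have hr4 := pow_le_of_pow_lt h.le_L hrL
  have hrL' : (r : ℝ) ≤ L := (le_self_pow₀ (by linarith) (by norm_num)).trans hrL.le
  set u := L / (2 * r) with hu
  have hu0 : 0 ≤ u := by positivity
  have hexp : 24 * r * L ≤ Real.exp u := by
    refine le_trans ?_ (Real.pow_div_factorial_le_exp u hu0 3)
    have h2 : u ^ 3 / (Nat.factorial 3 : ℕ) = L ^ 3 / (48 * r ^ 3) := by
      rw [hu]; norm_num [Nat.factorial]; field_simp; norm_num
    rw [h2, le_div_iff₀ (by positivity)]
    calc 24 * r * L * (48 * r ^ 3) = 1152 * (r : ℝ) ^ 4 * L := by ring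
      _ ≤ 3 * L * L := by nlinarith
      _ ≤ L ^ 3 := by
          have : (3 : ℝ) ≤ L := le_trans (by norm_num) h.le_L
          nlinarith [mul_pos hL hL]
  have hroot : Real.exp u * Real.exp u ≤ root r L * L := by
    have h3 : root r L * L = Real.exp ((L - Real.log L) / r + Real.log L) := by
      rw [Real.exp_add, Real.exp_log hL, root]
    rw [h3, ← Real.exp_add]
    apply Real.exp_le_exp.2
    have h4 : 0 ≤ Real.log L := Real.log_nonneg hL1
    have h5 : Real.log L / r ≤ Real.log L := div_le_self h4 (by linarith)
    have h6 : u + u = L / r := by rw [hu]; field_simp; ring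
    rw [h6, sub_div]
    linarith
  have hpow : root r L ^ (r - 1) * root r L = n / L := by
    rw [← root_pow h hr, ← pow_succ, Nat.sub_add_cancel (by omega)]
  have hmain : root r L ^ (r - 1) * Real.exp u ≤ n / (24 * r * L) := by
    have h7 : root r L ^ (r - 1) * Real.exp u * Real.exp u ≤ n := by
      calc root r L ^ (r - 1) * Real.exp u * Real.exp u
          = root r L ^ (r - 1) * (Real.exp u * Real.exp u) := by ring
        _ ≤ root r L ^ (r - 1) * (root r L * L) := by gcongr
        _ = root r L ^ (r - 1) * root r L * L := by ring
        _ = n := by rw [hpow]; field_simp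
    rw [le_div_iff₀ (by positivity)]
    refine le_trans ?_ h7
    gcongr
  have hone : 1 ≤ n / (96 * r * L) := by
    rw [one_le_div (by positivity)]
    refine le_trans ?_ h.L_le
    have : (96 : ℝ) ≤ L := le_trans (by norm_num) h.le_L
    calc 96 * r * L ≤ L * L * L := by gcongr
      _ = L ^ 3 := by ring
  have e1 : n / (48 * r * L) = 2 * (n / (96 * r * L)) := by field_simp; norm_num
  have e2 : n / (24 * r * L) = 4 * (n / (96 * r * L)) := by field_simp; norm_num
  rw [e2] at hmain
  rw [e1]
  linarith

lemma deviation_le (h : IsLarge n L) (hr : 2 ≤ r) (hrL : (r : ℝ) ^ 5 < L) {m : ℕ}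
    (hm : (n : ℝ) ^ 2 ≤ 4 * m * L) :
    4 * (r * blockLength n r L) ^ 2 ≤ m * n ^ 2 := by
  have hrR : (2 : ℝ) ≤ r := by exact_mod_cast hr
  have hL := h.pos
  have hn := h.n_pos
  have hr4 := pow_le_of_pow_lt h.le_L hrL
  have hκ0 := blockLength_pos h hr
  have hLn : L ≤ n ^ 2 := by
    have h1 : L ≤ n := (le_self_pow₀ h.one_le (by norm_num)).trans h.L_le
    have := h.one_le
    nlinarith
  have hκ : blockLength n r L * L ≤ 5 * r * n ^ 2 := by
    have h1 := mul_le_mul_of_nonneg_right (blockLength_le (r := r) h) hL.le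
    have h2 : (4 * r * n ^ 2 / L + 1) * L = 4 * r * (n : ℝ) ^ 2 + L := by field_simp
    have h3 : L ≤ r * (n : ℝ) ^ 2 := by nlinarith
    linarith
  have hfin : (4 * (r * blockLength n r L) ^ 2 : ℝ) ≤ m * n ^ 2 := by
    have hL2 : 0 < L ^ 2 := by positivity
    refine le_of_mul_le_mul_right ?_ hL2
    calc (4 * (r * blockLength n r L) ^ 2 : ℝ) * L ^ 2
        = 4 * (r : ℝ) ^ 2 * (blockLength n r L * L) ^ 2 := by ring
      _ ≤ 4 * (r : ℝ) ^ 2 * (5 * r * n ^ 2) ^ 2 := by gcongr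
      _ = 400 * r ^ 4 * ((n : ℝ) ^ 2 * n ^ 2) / 4 := by ring
      _ ≤ L * ((4 * m * L) * n ^ 2) / 4 := by gcongr
      _ = _ := by ring
  exact_mod_cast hfin

/-- The theorem for finite families of `n`-sets. -/
theorem exists_equitable {V : Type*} [Fintype V] [DecidableEq V] (h : IsLarge n L) (hr : 2 ≤ r)
    (hrL : (r : ℝ) ^ 5 < L) {m : ℕ} (hV : Fintype.card V = r * m) (E : Finset (Finset V))
    (hE : ∀ A ∈ E, A.card = n)
    (hcard : (E.card : ℝ) ≤ 0.01 * (n / L) ^ (((r : ℝ) - 1) / r) * (r : ℝ) ^ (n - 1)) :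
    ∃ c : V → Fin r, (∀ A ∈ E, ∀ i, ∃ v ∈ A, c v ≠ i) ∧
      ∀ i, (univ.filter fun v => c v = i).card = m := by
  have hn := h.n_pos
  have hn' : 0 < n := by exact_mod_cast hn
  have hL := h.pos
  have hrR : (2 : ℝ) ≤ r := by exact_mod_cast hr
  by_cases hm : 2 * m * L ≤ n * (n - 1)
  · refine exists_equitable_of_choose hV E hE fun ⟨A, hA⟩ => choose_lt_of_small h hr hcard hm ?_
    rw [← hE A hA, ← hV]
    exact card_le_univ A
  push Not at hm
  have hn2 : (2 : ℝ) ≤ n := by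
    refine le_trans ?_ h.L_le
    have : (2 : ℝ) ≤ L := le_trans (by norm_num) h.le_L
    exact this.trans (le_self_pow₀ h.one_le (by norm_num))
  have hm' : (n : ℝ) ^ 2 ≤ 4 * m * L := by nlinarith
  have hm0 : 0 < m := by
    rcases Nat.eq_zero_or_pos m with rfl | h0
    · exfalso
      rw [Nat.cast_zero] at hm'
      nlinarith
    · exact h0
  obtain ⟨D, hD⟩ := exists_blockLength_eq h hr
  have h1 := one_le_root (r := r) h
  have hroot : 0 < root r L := by linarith
  refine exists_equitable_of_spread hr hn' hn' hD hV hm0 (s := m / (12 * r * n))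
    (Nat.mul_div_le _ _) E hE (W := 0.02 * root r L ^ (r - 1) / r)
    (M := 1 / 40 * root r L ^ (r - 1) * Real.exp (L / (2 * r))) (by positivity) ?_ ?_
    (fun l hl => full_chain_le h hr hl) (fun l _ => default_chain_le h hr l)
    (deviation_le h hr hrL hm')
  · rw [rpow_eq_root_pow h hr] at hcard
    have hpow : (r : ℝ) ^ n = r ^ (n - 1) * r := by rw [← pow_succ, Nat.sub_add_cancel hn']
    rw [hpow, div_le_div_iff₀ (by positivity) (by positivity)]
    have : (0 : ℝ) ≤ r := by linarith
    nlinarith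
  · refine (default_chain_bound_le h hr hrL).trans ?_
    have h2 : (m : ℝ) / (12 * r * n : ℕ) < (m / (12 * r * n) : ℕ) + 1 := by
      rw [div_lt_iff₀ (by positivity)]
      exact_mod_cast Nat.lt_mul_of_div_lt (Nat.lt_succ_self _) (by positivity)
    have h3 : n / (48 * r * L) ≤ (m : ℝ) / (12 * r * n : ℕ) := by
      push_cast
      rw [div_le_div_iff₀ (by positivity) (by positivity)]
      have : 0 ≤ 12 * (r : ℝ) := by linarith
      nlinarith
    linarith

end

/-! ### Transfer to hypergraphs -/

section

lemma pow_five_lt_of_lt_rpow {x L : ℝ} (hx : 0 ≤ x) (hL : 0 ≤ L) (h : x < L ^ ((1 : ℝ) / 5)) :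
    x ^ 5 < L := by
  calc x ^ 5 < (L ^ ((1 : ℝ) / 5)) ^ 5 := by gcongr
    _ = L := by
        rw [← Real.rpow_natCast, ← Real.rpow_mul hL]
        norm_num

open Classical in
/-- The edges of a hypergraph as finsets of vertices. -/
noncomputable def edgeFinsets {α : Type*} (H : Hypergraph α) [Fintype H.vertexSet] :
    Finset (Finset H.vertexSet) :=
  univ.filter fun A => Subtype.val '' (A : Set H.vertexSet) ∈ H.edgeSet

lemma card_edgeFinsets_le {α : Type*} (H : Hypergraph α) [Fintype H.vertexSet] :
    (edgeFinsets H).card ≤ H.edgeSet.ncard := by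
  classical
  have hfin : H.edgeSet.Finite :=
    (Set.Finite.finite_subsets (Set.toFinite H.vertexSet)).subset fun e he =>
      H.subset_vertexSet_of_mem_edgeSet' he
  have hinj : Function.Injective fun A : Finset H.vertexSet => Subtype.val '' (A : Set H.vertexSet) :=
    (Set.image_injective.2 Subtype.val_injective).comp Finset.coe_injective
  rw [← Set.ncard_coe_finset, ← Set.ncard_image_of_injective _ hinj]
  refine Set.ncard_le_ncard ?_ hfin
  rintro _ ⟨A, hA, rfl⟩
  rw [mem_coe, edgeFinsets, mem_filter] at hA
  exact hA.2

lemma isEquitablyColorable_of_ncard_eq_zero {α : Type*} {H : Hypergraph α} {r : ℕ}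
    (hr : r = 1) (hV : H.vertexSet.Finite) (hE : H.edgeSet.ncard = 0) :
    H.IsEquitablyColorable r := by
  subst hr
  have hfin : H.edgeSet.Finite := hV.finite_subsets.subset fun e he =>
    H.subset_vertexSet_of_mem_edgeSet' he
  rw [Set.ncard_eq_zero hfin] at hE
  refine ⟨fun _ => 0, fun e he => ?_, fun i j => ?_⟩
  · rw [hE] at he
    exact absurd he (Set.notMem_empty e)
  · rw [Subsingleton.elim i j]
    exact le_self_add

end

end EquitableColoring

open EquitableColoring Finset in
theorem theorem1 :
    ∃ N : ℕ, ∀ n : ℕ, N ≤ n → ∀ r : ℕ, 1 ≤ r →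
      (r : ℝ) < Real.log (n : ℝ) ^ ((1 : ℝ) / 5) →
      ∀ (α : Type*) (H : Hypergraph α), H.vertexSet.Finite → H.IsUniform n →
        (H.edgeSet.ncard : ℝ) ≤
          0.01 * ((n : ℝ) / Real.log (n : ℝ)) ^ (((r : ℝ) - 1) / (r : ℝ)) * (r : ℝ) ^ (n - 1) →
        r ∣ H.vertexSet.ncard →
        H.IsEquitablyColorable r := by
  obtain ⟨N, hN⟩ := exists_isLarge
  refine ⟨N, fun n hn r hr hrL α H hfin hunif hcard hdvd => ?_⟩
  have hlarge := hN n hn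
  rcases Nat.lt_or_ge r 2 with hr1 | hr2
  · have hr1 : r = 1 := by omega
    refine isEquitablyColorable_of_ncard_eq_zero hr1 hfin ?_
    subst hr1
    norm_num at hcard
    have : (H.edgeSet.ncard : ℝ) < 1 := by linarith
    exact Nat.lt_one_iff.1 (by exact_mod_cast this)
  classical
  have := hfin.fintype
  obtain ⟨m, hm⟩ := hdvd
  have hV : Fintype.card H.vertexSet = r * m := by
    rw [← hm, ← Nat.card_coe_set_eq, Nat.card_eq_fintype_card]
  have hunif' : ∀ A ∈ edgeFinsets H, A.card = n := by
    intro A hA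
    have h1 := hunif _ (mem_filter.1 hA).2
    rw [Subtype.val_injective.encard_image, Set.encard_coe_eq_coe_finsetCard] at h1
    exact_mod_cast h1
  have hcard' := (Nat.cast_le (α := ℝ).2 (card_edgeFinsets_le H)).trans hcard
  obtain ⟨c, hc, hcm⟩ := exists_equitable hlarge hr2
    (pow_five_lt_of_lt_rpow (Nat.cast_nonneg r) hlarge.pos.le hrL) hV (edgeFinsets H) hunif' hcard'
  refine ⟨c, ?_, fun i j => ?_⟩
  · rintro e he ⟨i, hi⟩
    have himage : Subtype.val '' ((univ.filter fun v : H.vertexSet => (v : α) ∈ e : Finset _) :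
        Set H.vertexSet) = e := by
      ext x
      simp only [coe_filter, mem_univ, true_and, Set.mem_image, Set.mem_ofPred_eq, Subtype.exists,
        exists_and_left, exists_prop, exists_eq_right_right, and_iff_left_iff_imp]
      exact fun hx => H.subset_vertexSet_of_mem_edgeSet' he hx
    obtain ⟨v, hv, hne⟩ := hc (univ.filter fun v : H.vertexSet => (v : α) ∈ e)
      (mem_filter.2 ⟨mem_univ _, by rw [himage]; exact he⟩) i
    exact hne (hi v (mem_filter.1 hv).2)
  · have hclass : ∀ k, (H.colorClass c k).encard = m := by
      intro k
      have : H.colorClass c k = ((univ.filter fun v => c v = k : Finset _) : Set H.vertexSet) := by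
        ext v; simp [Hypergraph.colorClass]
      rw [this, Set.encard_coe_eq_coe_finsetCard, hcm]
    rw [hclass, hclass]
    exact le_self_add
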